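/- Let $M$ be a compact connected manifold and let $G$ be a connected Lie group acting continuously and transitively on a compact connected (Hausdorff) homogeneous space $X$. Let $T\colon M\to M$ be a continuous map homotopic to the identity, let $A\colon M\to G$ be continuous, let $\mathbb F$ be a field, and let $1\le k\le \dim M$ be an integer. Write $H_i(\,\cdot\,,\mathbb F)$ for singular homology with coefficients in $\mathbb F$. Assume that 1. $H_k(M,\mathbb F)\neq\{0\}$; 2. for every $0<i<k$, either $H_i(M,\mathbb F)=\{0\}$ or $H_{k-i}(X,\mathbb F)=\{0\}$; 3. for some $p\in X$, the map $A_p\colon M\to X$, $A_p(x):=A(x)\,p$, induces a non-zero linear map $(A_p)_*\colon H_k(M,\mathbb F)\to H_k(X,\mathbb F)$. Then the skew product $F\colon M\times X\to M\times X$, $F(x,p):=(Tx,\,A(x)\,p)$, has no invariant section: there is no continuous map $\sigma\colon M\to X$ such that $F(x,\sigma(x))=(Tx,\,\sigma(Tx))$ for all $x\in M$. -/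

import Mathlib

open scoped Manifold ContDiff

universe u v

namespace InvariantSection

/-- The `n`-th singular homology functor `H_n(-, F)` with coefficients in the field `F`. -/
noncomputable def singularHomology (F : Type u) [Field F] (n : ℕ) :
    CategoryTheory.Functor TopCat.{u} (ModuleCat.{u} F) :=
  (AlgebraicTopology.singularHomologyFunctor (ModuleCat.{u} F) n).obj (ModuleCat.of F F)

/-- The `F`-vector space `H_n(Y, F)`. -/
noncomputable abbrev H (F : Type u) [Field F] (n : ℕ) (Y : Type u) [TopologicalSpace Y] : ModuleCat.{u} F :=
  (singularHomology F n).obj (TopCat.of Y)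

/-- The linear map `f_* : H_n(Y, F) → H_n(Z, F)` induced by a continuous map `f : Y → Z`. -/
noncomputable def inducedMap (F : Type u) [Field F] (n : ℕ) {Y Z : Type u} [TopologicalSpace Y]
    [TopologicalSpace Z] (f : C(Y, Z)) : H F n Y →ₗ[F] H F n Z :=
  ((singularHomology F n).map (TopCat.ofHom f)).hom

section Dynamics

variable {M X : Type u} {G : Type v} [TopologicalSpace M] [TopologicalSpace X]
  [TopologicalSpace G] [SMul G X]

/-- The skew product `(x, p) ↦ (T x, A(x) p)`. -/
def skewProduct (T : M → M) (A : M → G) : M × X → M × X :=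
  fun q => (T q.1, A q.1 • q.2)

/-- `σ : M → X` is an `F`-invariant section of the skew product `F` of `T` and `A`: it is
continuous and `F(x, σ(x)) = (T x, σ(T x))` for all `x`. -/
structure IsInvariantSection (T : M → M) (A : M → G) (σ : M → X) : Prop where
  continuous : Continuous σ
  invariant : ∀ x, skewProduct T A (x, σ x) = (T x, σ (T x))

/-- The map `A_p : M → X`, `x ↦ A(x) p`. -/
def orbitMap [ContinuousSMul G X] (A : C(M, G)) (p : X) : C(M, X) where
  toFun x := A x • p
  continuous_toFun := A.continuous.smul continuous_const

end Dynamics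

end InvariantSection

/-! An invariant section σ satisfies A(x)σ(x) = σ(Tx). Put φ(x, q) = A(x)q on M × X, so that φ ∘
(id, σ) = σ ∘ T. When the mixed Künneth terms vanish in degree k, the class of (id, σ)_*c in H_k(M ×
X) is the sum of its parts along the two factors, (id, p)_*c + (x₀, σ)_*c. Applying φ_* gives (σ ∘
T)_* = (A_p)_* + (A(x₀)σ)_* on H_k(M). Now σ ∘ T is homotopic to σ because T is homotopic to the
identity, and A(x₀)σ is homotopic to σ along a path from A(x₀) to 1 in G. Hence (A_p)_* = 0, a
contradiction.

The Künneth statement (`kunneth_of_acyclic`) is proved on chains of simplicial sets. By acyclic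
models, the cross product commutes with boundaries (`boundary_cross`) and its composite with the
Alexander-Whitney map is homotopic to the identity (`boundary_ezHomotopy`); the composite in the
other order is not needed. Over a field, the boundary has a graded generalized inverse, so each
complex retracts up to homotopy onto cycles by a projection killing boundaries. After projecting
both factors, every Alexander-Whitney term is a tensor of cycles, so an acyclic factor makes a mixed
term a boundary and only the two extreme terms survive (`map_proj_alexanderWhitney_mem`).

Chains of all degrees live in one module; the grading is recovered from sign, component and
augmentation operators. -/

namespace SimplicialChains

open CategoryTheory Simplicial MonoidalCategory CartesianMonoidalCategory

universe w

/-! ### Total simplicial chains and contractions of products of simplices -/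

variable (F : Type u) [CommRing F]

/-- The total module of simplicial chains of a simplicial set, in all degrees at once. -/
def Chains (S : SSet.{w}) : Type (max u w) := (Σ n : ℕ, S _⦋n⦌) →₀ F

variable {S Y Z : SSet.{w}}

noncomputable instance : AddCommGroup (Chains F S) :=
  inferInstanceAs (AddCommGroup ((Σ n : ℕ, S _⦋n⦌) →₀ F))

noncomputable instance : Module F (Chains F S) :=
  inferInstanceAs (Module F ((Σ n : ℕ, S _⦋n⦌) →₀ F))

/-- A simplex, as a chain. -/
noncomputable def simplexChain {n : ℕ} (x : S _⦋n⦌) : Chains F S := Finsupp.single ⟨n, x⟩ 1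

variable {F} in
theorem Chains.map_mem {V : Type*} [AddCommMonoid V]
    [Module F V] {f : Chains F S →ₗ[F] V} {R : Submodule F V}
    (h : ∀ (n : ℕ) (x : S _⦋n⦌), f (simplexChain F x) ∈ R) (c : Chains F S) : f c ∈ R := by
  have key : ∀ c : (Σ n : ℕ, S _⦋n⦌) →₀ F, f c ∈ R := fun c => by
    induction c using Finsupp.induction_linear with
    | zero => exact (map_zero f).symm ▸ R.zero_mem
    | add a b ha hb => exact (map_add f a b).symm ▸ R.add_mem ha hb
    | single x r =>
      have : Finsupp.single x r = r • Finsupp.single x (1 : F) := by simp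
      rw [this]
      exact (map_smul f r (simplexChain F x.2)).symm ▸ R.smul_mem _ (h _ _)
  exact key c

variable {F} in
theorem Chains.hom_ext {V : Type*} [AddCommMonoid V] [Module F V] {f g : Chains F S →ₗ[F] V}
    (h : ∀ (n : ℕ) (x : S _⦋n⦌), f (simplexChain F x) = g (simplexChain F x)) : f = g :=
  Finsupp.lhom_ext' (M := F) (R := F) fun ⟨n, x⟩ => LinearMap.ext_ring (h n x)

/-- The linear map on chains with given values on simplices. -/
noncomputable def chainsLift {V : Type*} [AddCommMonoid V] [Module F V]
    (f : ∀ n : ℕ, S _⦋n⦌ → V) : Chains F S →ₗ[F] V :=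
  Finsupp.linearCombination F fun x : Σ n : ℕ, S _⦋n⦌ => f x.1 x.2

@[simp]
theorem chainsLift_simplexChain {V : Type*} [AddCommMonoid V] [Module F V]
    (f : ∀ n : ℕ, S _⦋n⦌ → V) {n : ℕ} (x : S _⦋n⦌) :
    chainsLift F f (simplexChain F x) = f n x := by
  exact (Finsupp.linearCombination_single F 1 _).trans (one_smul F _)

/-- The boundary of a simplex. -/
noncomputable def simplexBoundary (n : ℕ) : S _⦋n⦌ → Chains F S :=
  match n with
  | 0 => fun _ => 0
  | n + 1 => fun x => ∑ i : Fin (n + 2), (-1 : F) ^ (i : ℕ) • simplexChain F (S.δ i x)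

/-- The total boundary operator. -/
noncomputable def boundary (S : SSet.{w}) : Chains F S →ₗ[F] Chains F S :=
  chainsLift F (simplexBoundary F)

@[simp]
theorem boundary_simplexChain_zero (x : S _⦋0⦌) : boundary F S (simplexChain F x) = 0 := by
  simp [boundary, simplexBoundary]

@[simp]
theorem boundary_simplexChain_succ {n : ℕ} (x : S _⦋n + 1⦌) :
    boundary F S (simplexChain F x) =
      ∑ i : Fin (n + 2), (-1 : F) ^ (i : ℕ) • simplexChain F (S.δ i x) := by
  simp [boundary, simplexBoundary]

/-- The sign operator, multiplication by `(-1) ^ n` in degree `n`. -/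
noncomputable def signOp (S : SSet.{w}) : Chains F S →ₗ[F] Chains F S :=
  chainsLift F fun n x => (-1 : F) ^ n • simplexChain F x

@[simp]
theorem signOp_simplexChain {n : ℕ} (x : S _⦋n⦌) :
    signOp F S (simplexChain F x) = (-1 : F) ^ n • simplexChain F x := by
  simp [signOp]

/-- The augmentation, vanishing in positive degrees. -/
noncomputable def augmentation (S : SSet.{w}) : Chains F S →ₗ[F] F :=
  chainsLift F fun n _ => if n = 0 then 1 else 0

@[simp]
theorem augmentation_simplexChain {n : ℕ} (x : S _⦋n⦌) :
    augmentation F S (simplexChain F x) = if n = 0 then 1 else 0 := by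
  simp [augmentation]

/-- The map induced on chains by a morphism of simplicial sets. -/
noncomputable def chainsMap (f : S ⟶ Y) : Chains F S →ₗ[F] Chains F Y :=
  chainsLift F fun _ x => simplexChain F (f.app _ x)

@[simp]
theorem chainsMap_simplexChain (f : S ⟶ Y) {n : ℕ} (x : S _⦋n⦌) :
    chainsMap F f (simplexChain F x) = simplexChain F (f.app _ x) := by
  simp [chainsMap]

theorem chainsMap_comp (f : S ⟶ Y) (g : Y ⟶ Z) :
    chainsMap F (f ≫ g) = chainsMap F g ∘ₗ chainsMap F f :=
  Chains.hom_ext fun n x => by simp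

theorem chainsMap_comp_apply (f : S ⟶ Y) (g : Y ⟶ Z) (c : Chains F S) :
    chainsMap F (f ≫ g) c = chainsMap F g (chainsMap F f c) := by
  rw [chainsMap_comp]; rfl

@[simp]
theorem chainsMap_id : chainsMap F (𝟙 S) = LinearMap.id :=
  Chains.hom_ext fun n x => by simp

/-- The simplicial identity matches the pair (j, i), j ≤ i, with the pair (i + 1, j); the double
faces agree and the signs are opposite. -/
theorem sum_δ_δ_eq_zero {V : Type*} [AddCommGroup V] [Module F V] {n : ℕ} (x : S _⦋n + 2⦌)
    (g : S _⦋n⦌ → V) :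
    ∑ j : Fin (n + 3), ∑ i : Fin (n + 2),
      ((-1 : F) ^ (j : ℕ) * (-1 : F) ^ (i : ℕ)) • g (S.δ i (S.δ j x)) = 0 := by
  rw [← Fintype.sum_prod_type', ← Finset.sum_filter_add_sum_filter_not _
    (fun ji : Fin (n + 3) × Fin (n + 2) => (ji.1 : ℕ) ≤ (ji.2 : ℕ)), ← eq_neg_iff_add_eq_zero,
    ← Finset.sum_neg_distrib]
  refine Finset.sum_bij' (fun ji h => (ji.2.succ, Fin.castLT ji.1 ?_))
    (fun ji h => (Fin.castSucc ji.2, ji.1.pred ?_)) ?_ ?_ ?_ ?_ ?_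
  · have := (Finset.mem_filter.mp h).2; omega
  · have := (Finset.mem_filter.mp h).2
    rintro h0; simp [h0] at this
  · rintro ⟨j, i⟩ h
    simp only [Finset.mem_filter, Finset.mem_univ, true_and] at h ⊢
    simp; omega
  · rintro ⟨j, i⟩ h
    simp only [Finset.mem_filter, Finset.mem_univ, true_and] at h ⊢
    simp; omega
  · rintro ⟨j, i⟩ h; simp
  · rintro ⟨j, i⟩ h; simp
  · rintro ⟨j, i⟩ h
    simp only [Finset.mem_filter, Finset.mem_univ, true_and] at h
    simp only [Fin.val_succ, Fin.val_castLT, pow_succ, mul_neg, mul_one, neg_mul, neg_smul, neg_neg]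
    rw [mul_comm]
    congr 2
    exact (ConcreteCategory.congr_hom (S.δ_comp_δ'' (i := j) (j := i) (by simpa using! h)) x).symm

theorem boundary_comp_boundary : boundary F S ∘ₗ boundary F S = 0 := by
  refine Chains.hom_ext fun n x => ?_
  match n, x with
  | 0, x => simp
  | 1, x => simp
  | n + 2, x => simpa [Finset.smul_sum, smul_smul] using
      sum_δ_δ_eq_zero F x (fun y => simplexChain F y)

@[simp]
theorem boundary_boundary (c : Chains F S) : boundary F S (boundary F S c) = 0 :=
  LinearMap.congr_fun (boundary_comp_boundary F) c

theorem boundary_chainsMap (f : S ⟶ Y) (c : Chains F S) :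
    boundary F Y (chainsMap F f c) = chainsMap F f (boundary F S c) := by
  refine LinearMap.congr_fun (f := boundary F Y ∘ₗ chainsMap F f)
    (g := chainsMap F f ∘ₗ boundary F S) (Chains.hom_ext fun n x => ?_) c
  cases n with
  | zero => simp
  | succ n =>
    simp only [LinearMap.comp_apply, chainsMap_simplexChain, boundary_simplexChain_succ, map_sum,
      map_smul]
    refine Finset.sum_congr rfl fun i _ => ?_
    congr 2
    exact (ConcreteCategory.congr_hom (SimplicialObject.δ_naturality f i) x).symm

theorem signOp_chainsMap (f : S ⟶ Y) (c : Chains F S) :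
    signOp F Y (chainsMap F f c) = chainsMap F f (signOp F S c) := by
  refine LinearMap.congr_fun (f := signOp F Y ∘ₗ chainsMap F f)
    (g := chainsMap F f ∘ₗ signOp F S) (Chains.hom_ext fun n x => ?_) c
  simp

@[simp]
theorem augmentation_chainsMap (f : S ⟶ Y) (c : Chains F S) :
    augmentation F Y (chainsMap F f c) = augmentation F S c := by
  refine LinearMap.congr_fun (f := augmentation F Y ∘ₗ chainsMap F f)
    (g := augmentation F S) (Chains.hom_ext fun n x => ?_) c
  simp

@[simp]
theorem signOp_signOp (c : Chains F S) : signOp F S (signOp F S c) = c := by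
  refine LinearMap.congr_fun (f := signOp F S ∘ₗ signOp F S)
    (g := LinearMap.id) (Chains.hom_ext fun n x => ?_) c
  simp [smul_smul, ← mul_pow]

theorem signOp_boundary (c : Chains F S) :
    signOp F S (boundary F S c) = - boundary F S (signOp F S c) := by
  refine LinearMap.congr_fun (f := signOp F S ∘ₗ boundary F S)
    (g := -(boundary F S ∘ₗ signOp F S)) (Chains.hom_ext fun n x => ?_) c
  cases n with
  | zero => simp
  | succ n =>
    simp only [LinearMap.comp_apply, boundary_simplexChain_succ, map_sum, map_smul,
      signOp_simplexChain, LinearMap.neg_apply, Finset.smul_sum, ← Finset.sum_neg_distrib]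
    refine Finset.sum_congr rfl fun i _ => ?_
    rw [pow_succ, smul_comm]; simp

/-- The operator on chains induced by an operation raising the degree of simplices by one. -/
noncomputable def coneOp (e : ∀ n : ℕ, S _⦋n⦌ → S _⦋n + 1⦌) : Chains F S →ₗ[F] Chains F S :=
  chainsLift F fun n x => simplexChain F (e n x)

@[simp]
theorem coneOp_simplexChain (e : ∀ n : ℕ, S _⦋n⦌ → S _⦋n + 1⦌) {n : ℕ} (x : S _⦋n⦌) :
    coneOp F e (simplexChain F x) = simplexChain F (e n x) := by
  simp [coneOp]

@[simp]
theorem augmentation_coneOp (e : ∀ n : ℕ, S _⦋n⦌ → S _⦋n + 1⦌) (c : Chains F S) :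
    augmentation F S (coneOp F e c) = 0 := by
  refine LinearMap.congr_fun (f := augmentation F S ∘ₗ coneOp F e)
    (g := 0) (Chains.hom_ext fun n x => ?_) c
  simp

/-- An extra degeneracy contracts the total complex onto a vertex. -/
theorem boundary_coneOp (e : ∀ n : ℕ, S _⦋n⦌ → S _⦋n + 1⦌) (v : S _⦋0⦌)
    (h₀ : ∀ (n : ℕ) (x : S _⦋n⦌), S.δ 0 (e n x) = x)
    (h₁ : ∀ (n : ℕ) (x : S _⦋n + 1⦌) (i : Fin (n + 2)), S.δ i.succ (e (n + 1) x) = e n (S.δ i x))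
    (hv : ∀ x : S _⦋0⦌, S.δ 1 (e 0 x) = v) (c : Chains F S) :
    boundary F S (coneOp F e c) =
      c - coneOp F e (boundary F S c) - augmentation F S c • simplexChain F v := by
  refine LinearMap.congr_fun (f := boundary F S ∘ₗ coneOp F e)
    (g := LinearMap.id - coneOp F e ∘ₗ boundary F S -
      (augmentation F S).smulRight (simplexChain F v)) (Chains.hom_ext fun n x => ?_) c
  cases n with
  -- In degree 0 the second face of the cone edge is `v` instead of a cone on a face; this is the
  -- source of the augmentation term.
  | zero => simp [Fin.sum_univ_two, h₀, hv, sub_eq_add_neg]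
  | succ n =>
    simp only [LinearMap.comp_apply, coneOp_simplexChain, boundary_simplexChain_succ,
      LinearMap.sub_apply, LinearMap.id_apply, map_sum, map_smul, LinearMap.smulRight_apply,
      augmentation_simplexChain]
    rw [Fin.sum_univ_succ]
    simp [h₀, h₁, pow_succ, sub_eq_add_neg]

/-- The extra degeneracy of a product of standard simplices which adds the initial vertex. -/
def addInitialVertex (p q n : ℕ) (z : (Δ[p] ⊗ Δ[q] : SSet.{w}) _⦋n⦌) :
    (Δ[p] ⊗ Δ[q] : SSet.{w}) _⦋n + 1⦌ :=
  (SSet.stdSimplex.objEquiv.symm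
      (SSet.Augmented.StandardSimplex.shift (SSet.stdSimplex.objEquiv z.1)),
    SSet.stdSimplex.objEquiv.symm
      (SSet.Augmented.StandardSimplex.shift (SSet.stdSimplex.objEquiv z.2)))

/-- The contraction of the chains of a product of standard simplices onto the initial vertex. -/
noncomputable def cone (p q : ℕ) :
    Chains F (Δ[p] ⊗ Δ[q] : SSet.{w}) →ₗ[F] Chains F (Δ[p] ⊗ Δ[q] : SSet.{w}) :=
  coneOp F (addInitialVertex p q)

/-- Prepending the vertex (0, 0) is an extra degeneracy. The resulting explicit primitive is the
form in which acyclicity of the models is used in both constructions below. -/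
theorem boundary_cone {p q : ℕ} {c : Chains F (Δ[p] ⊗ Δ[q] : SSet.{w})}
    (hc : boundary F _ c = 0) (hc' : augmentation F _ c = 0) :
    boundary F _ (cone F p q c) = c := by
  have h := boundary_coneOp F (addInitialVertex p q)
    ((SSet.stdSimplex.obj₀Equiv.symm 0, SSet.stdSimplex.obj₀Equiv.symm 0) :
      (Δ[p] ⊗ Δ[q] : SSet.{w}) _⦋0⦌) ?_ ?_ ?_ c
  · rw [hc, hc', map_zero, zero_smul, sub_zero, sub_zero] at h
    exact h
  · rintro n ⟨x, y⟩
    refine Prod.ext ?_ ?_ <;> refine SSet.stdSimplex.ext _ _ fun j => ?_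
    · exact SSet.Augmented.StandardSimplex.shiftFun_succ (fun k => x k) j
    · exact SSet.Augmented.StandardSimplex.shiftFun_succ (fun k => y k) j
  · rintro n ⟨x, y⟩ i
    refine Prod.ext ?_ ?_ <;> refine SSet.stdSimplex.ext _ _ fun j => ?_
    · refine Fin.cases ?_ (fun j => ?_) j
      · rfl
      · exact congrArg (SSet.Augmented.StandardSimplex.shiftFun (fun k => x k))
          (Fin.succ_succAbove_succ i j)
    · refine Fin.cases ?_ (fun j => ?_) j
      · rfl
      · exact congrArg (SSet.Augmented.StandardSimplex.shiftFun (fun k => y k))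
          (Fin.succ_succAbove_succ i j)
  · rintro ⟨x, y⟩
    refine Prod.ext ?_ ?_ <;> refine SSet.stdSimplex.ext _ _ fun j => ?_
    · obtain rfl := Subsingleton.elim (α := Fin 1) j 0
      rfl
    · obtain rfl := Subsingleton.elim (α := Fin 1) j 0
      rfl

@[simp]
theorem augmentation_cone {p q : ℕ} (c : Chains F (Δ[p] ⊗ Δ[q] : SSet.{w})) :
    augmentation F _ (cone F p q c) = 0 :=
  augmentation_coneOp F _ c

end SimplicialChains

/-! ### The cross product by acyclic models -/

namespace SimplicialChains

open CategoryTheory Simplicial MonoidalCategory CartesianMonoidalCategory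

universe w

variable (F : Type u) [CommRing F] {S Y S' Y' : SSet.{w}}

open scoped TensorProduct

/-- The Eilenberg-Zilber chain: a fundamental chain of the product of two standard simplices,
obtained by coning off its boundary. -/
noncomputable def fundamentalChain (p q : ℕ) : Chains F (Δ[p] ⊗ Δ[q] : SSet.{w}) :=
  match p, q with
  | p, 0 => chainsMap F (lift (𝟙 _) (SSet.const (SSet.stdSimplex.obj₀Equiv.symm 0)))
      (simplexChain F (SSet.yonedaEquiv (𝟙 Δ[p])))
  | 0, q + 1 => chainsMap F (lift (SSet.const (SSet.stdSimplex.obj₀Equiv.symm 0)) (𝟙 _))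
      (simplexChain F (SSet.yonedaEquiv (𝟙 Δ[q + 1])))
  -- The coned chain is the Leibniz formula for the required boundary, written with faces because
  -- `cross` is itself defined from these chains.
  | p + 1, q + 1 => cone F (p + 1) (q + 1)
      (∑ i : Fin (p + 2), (-1 : F) ^ (i : ℕ) •
          chainsMap F (SSet.stdSimplex.δ i ⊗ₘ 𝟙 Δ[q + 1]) (fundamentalChain p (q + 1)) +
        (-1 : F) ^ (p + 1) • ∑ j : Fin (q + 2), (-1 : F) ^ (j : ℕ) •
          chainsMap F (𝟙 Δ[p + 1] ⊗ₘ SSet.stdSimplex.δ j) (fundamentalChain (p + 1) q))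
termination_by p + q

/-- The cross product of chains. -/
noncomputable def cross (S Y : SSet.{w}) :
    Chains F S ⊗[F] Chains F Y →ₗ[F] Chains F (S ⊗ Y) :=
  TensorProduct.lift (chainsLift F fun p x => chainsLift F fun q y =>
    chainsMap F (SSet.yonedaEquiv.symm x ⊗ₘ SSet.yonedaEquiv.symm y) (fundamentalChain F p q))

theorem cross_simplexChain {p q : ℕ} (x : S _⦋p⦌) (y : Y _⦋q⦌) :
    cross F S Y (simplexChain F x ⊗ₜ simplexChain F y) =
      chainsMap F (SSet.yonedaEquiv.symm x ⊗ₘ SSet.yonedaEquiv.symm y)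
        (fundamentalChain F p q) := by
  simp [cross]

variable {F} in
theorem tensor_hom_ext {V : Type*} [AddCommMonoid V] [Module F V]
    {f g : Chains F S ⊗[F] Chains F Y →ₗ[F] V}
    (h : ∀ (p : ℕ) (x : S _⦋p⦌) (q : ℕ) (y : Y _⦋q⦌),
      f (simplexChain F x ⊗ₜ simplexChain F y) = g (simplexChain F x ⊗ₜ simplexChain F y)) :
    f = g :=
  TensorProduct.ext (Chains.hom_ext fun p x => Chains.hom_ext fun q y => h p x q y)

theorem chainsMap_cross (f : S ⟶ S') (g : Y ⟶ Y') (t : Chains F S ⊗[F] Chains F Y) :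
    chainsMap F (f ⊗ₘ g) (cross F S Y t) =
      cross F S' Y' (TensorProduct.map (chainsMap F f) (chainsMap F g) t) := by
  refine LinearMap.congr_fun (f := chainsMap F (f ⊗ₘ g) ∘ₗ cross F S Y)
    (g := cross F S' Y' ∘ₗ TensorProduct.map (chainsMap F f) (chainsMap F g))
    (tensor_hom_ext fun p x q y => ?_) t
  simp only [LinearMap.comp_apply, TensorProduct.map_tmul, chainsMap_simplexChain,
    cross_simplexChain, ← chainsMap_comp_apply, tensorHom_comp_tensorHom,
    SSet.yonedaEquiv_symm_comp]

/-- The boundary operator of the tensor product of total chain complexes. -/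
noncomputable def tensorBoundary (S Y : SSet.{w}) :
    Chains F S ⊗[F] Chains F Y →ₗ[F] Chains F S ⊗[F] Chains F Y :=
  TensorProduct.map (boundary F S) LinearMap.id + TensorProduct.map (signOp F S) (boundary F Y)

theorem tensorBoundary_tmul (a : Chains F S) (b : Chains F Y) :
    tensorBoundary F S Y (a ⊗ₜ b) = boundary F S a ⊗ₜ b + signOp F S a ⊗ₜ boundary F Y b := by
  simp [tensorBoundary]

theorem tensorBoundary_tensorBoundary (t : Chains F S ⊗[F] Chains F Y) :
    tensorBoundary F S Y (tensorBoundary F S Y t) = 0 := by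
  refine LinearMap.congr_fun (f := tensorBoundary F S Y ∘ₗ tensorBoundary F S Y)
    (g := 0) (TensorProduct.ext' fun a b => ?_) t
  simp [tensorBoundary_tmul, signOp_boundary, TensorProduct.neg_tmul]

theorem tensorBoundary_map_chainsMap (f : S ⟶ S') (g : Y ⟶ Y')
    (t : Chains F S ⊗[F] Chains F Y) :
    tensorBoundary F S' Y' (TensorProduct.map (chainsMap F f) (chainsMap F g) t) =
      TensorProduct.map (chainsMap F f) (chainsMap F g) (tensorBoundary F S Y t) := by
  refine LinearMap.congr_fun
    (f := tensorBoundary F S' Y' ∘ₗ TensorProduct.map (chainsMap F f) (chainsMap F g))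
    (g := TensorProduct.map (chainsMap F f) (chainsMap F g) ∘ₗ tensorBoundary F S Y)
    (TensorProduct.ext' fun a b => ?_) t
  simp [tensorBoundary_tmul, boundary_chainsMap, signOp_chainsMap]

theorem chainsMap_yonedaEquiv_symm {n : ℕ} (x : S _⦋n⦌) :
    chainsMap F (SSet.yonedaEquiv.symm x) (simplexChain F (SSet.yonedaEquiv (𝟙 Δ[n]))) =
      simplexChain F x := by
  rw [chainsMap_simplexChain, SSet.yonedaEquiv_symm_app_id]

theorem tensorHom_eq_cross {p q : ℕ} (f : Δ[p] ⟶ S) (g : Δ[q] ⟶ Y) :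
    chainsMap F (f ⊗ₘ g) (fundamentalChain F p q) = cross F S Y
      (simplexChain F (SSet.yonedaEquiv f) ⊗ₜ simplexChain F (SSet.yonedaEquiv g)) := by
  rw [cross_simplexChain, Equiv.symm_apply_apply, Equiv.symm_apply_apply]

theorem const_app_zero (x : S _⦋0⦌) (y : Y _⦋0⦌) :
    (SSet.const x : Y ⟶ S).app (Opposite.op ⦋0⦌) y = x := by
  simp

/-- The cross product with a vertex on the right. -/
theorem cross_vertex_right (c : Chains F S) (y : Y _⦋0⦌) :
    cross F S Y (c ⊗ₜ simplexChain F y) = chainsMap F (lift (𝟙 S) (SSet.const y)) c := by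
  refine LinearMap.congr_fun
    (f := cross F S Y ∘ₗ (TensorProduct.mk F _ _).flip (simplexChain F y))
    (g := chainsMap F (lift (𝟙 S) (SSet.const y))) (Chains.hom_ext fun n x => ?_) c
  have h : lift (SSet.yonedaEquiv.symm x) (SSet.const y) =
      SSet.yonedaEquiv.symm x ≫ lift (𝟙 S) (SSet.const y) := by
    rw [comp_lift, Category.comp_id, SSet.comp_const]
  simp only [LinearMap.comp_apply, LinearMap.flip_apply, TensorProduct.mk_apply,
    cross_simplexChain]
  rw [fundamentalChain, ← chainsMap_comp_apply, lift_map, SSet.yonedaEquiv_symm_zero, SSet.comp_const,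
    Category.id_comp, h, chainsMap_comp_apply, chainsMap_yonedaEquiv_symm]

/-- The cross product with a vertex on the left. -/
theorem cross_vertex_left (x : S _⦋0⦌) (c : Chains F Y) :
    cross F S Y (simplexChain F x ⊗ₜ c) = chainsMap F (lift (SSet.const x) (𝟙 Y)) c := by
  refine LinearMap.congr_fun
    (f := cross F S Y ∘ₗ TensorProduct.mk F _ _ (simplexChain F x))
    (g := chainsMap F (lift (SSet.const x) (𝟙 Y))) (Chains.hom_ext fun n y => ?_) c
  have h : lift (SSet.const x) (SSet.yonedaEquiv.symm y) =
      SSet.yonedaEquiv.symm y ≫ lift (SSet.const x) (𝟙 Y) := by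
    rw [comp_lift, Category.comp_id, SSet.comp_const]
  cases n with
  | zero =>
    simp only [LinearMap.comp_apply, TensorProduct.mk_apply]
    rw [cross_vertex_right, chainsMap_simplexChain, chainsMap_simplexChain]
    congr 1
    refine Prod.ext ?_ ?_
    · exact (const_app_zero x y).symm
    · exact const_app_zero y x
  | succ n =>
    simp only [LinearMap.comp_apply, TensorProduct.mk_apply, cross_simplexChain]
    rw [fundamentalChain, ← chainsMap_comp_apply, lift_map, SSet.yonedaEquiv_symm_zero, SSet.comp_const,
      Category.id_comp, h, chainsMap_comp_apply, chainsMap_yonedaEquiv_symm]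

/-- The augmentation sees only degree 0, and coned chains have none. This supplies the augmentation
condition of `boundary_cone` when the boundary of a product of simplices is filled. -/
theorem augmentation_fundamentalChain {p q : ℕ} (h : 0 < p + q) :
    augmentation F _ (fundamentalChain.{u, w} F p q) = 0 := by
  match p, q with
  | p, 0 =>
    rw [fundamentalChain, augmentation_chainsMap, augmentation_simplexChain, if_neg (by omega)]
  | 0, q + 1 =>
    rw [fundamentalChain, augmentation_chainsMap, augmentation_simplexChain, if_neg (by omega)]
  | p + 1, q + 1 => simp [fundamentalChain]

theorem augmentation_cross_simplexChain {p q : ℕ} (h : 0 < p + q) (x : S _⦋p⦌) (y : Y _⦋q⦌) :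
    augmentation F _ (cross F S Y (simplexChain F x ⊗ₜ simplexChain F y)) = 0 := by
  rw [cross_simplexChain, augmentation_chainsMap, augmentation_fundamentalChain F h]

theorem boundary_yonedaEquiv_id (n : ℕ) :
    boundary F _ (simplexChain F (SSet.yonedaEquiv (𝟙 (Δ[n + 1] : SSet.{w})))) =
      ∑ i : Fin (n + 2), (-1 : F) ^ (i : ℕ) •
        simplexChain F (SSet.yonedaEquiv (SSet.stdSimplex.δ i)) := by
  rw [boundary_simplexChain_succ]
  rfl

theorem fundamentalChain_succ_succ (p q : ℕ) :
    fundamentalChain.{u, w} F (p + 1) (q + 1) = cone F (p + 1) (q + 1)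
      (cross F _ _ (tensorBoundary F _ _ (simplexChain F (SSet.yonedaEquiv (𝟙 Δ[p + 1])) ⊗ₜ
        simplexChain F (SSet.yonedaEquiv (𝟙 Δ[q + 1]))))) := by
  rw [fundamentalChain, tensorBoundary_tmul, boundary_yonedaEquiv_id, boundary_yonedaEquiv_id,
    signOp_simplexChain]
  simp only [tensorHom_eq_cross, TensorProduct.sum_tmul, TensorProduct.tmul_sum, map_sum, map_add,
    ← TensorProduct.smul_tmul', TensorProduct.tmul_smul, map_smul, Finset.smul_sum]
  exact congrArg₂ _ rfl (Finset.sum_congr rfl fun j _ => smul_comm _ _ _)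

/-- Naturality reduces the claim to the top simplices of Δ[p] and Δ[q], where the chain was built as
a cone on the desired boundary; it remains to see that this boundary is a cycle of augmentation
zero. -/
theorem boundary_cross_simplexChain (p q : ℕ) {S Y : SSet.{w}} (x : S _⦋p⦌) (y : Y _⦋q⦌) :
    boundary F _ (cross F S Y (simplexChain F x ⊗ₜ simplexChain F y)) =
      cross F S Y (tensorBoundary F S Y (simplexChain F x ⊗ₜ simplexChain F y)) := by
  match p, q with
  | p, 0 =>
    rw [cross_vertex_right, tensorBoundary_tmul, boundary_simplexChain_zero, TensorProduct.tmul_zero,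
      add_zero, cross_vertex_right, boundary_chainsMap]
  | 0, q + 1 =>
    rw [cross_vertex_left, tensorBoundary_tmul, boundary_simplexChain_zero, TensorProduct.zero_tmul,
      zero_add, signOp_simplexChain, pow_zero, one_smul, cross_vertex_left, boundary_chainsMap]
  | p + 1, q + 1 =>
    have key : boundary F _ (fundamentalChain.{u, w} F (p + 1) (q + 1)) =
        cross F _ _ (tensorBoundary F _ _ (simplexChain F (SSet.yonedaEquiv (𝟙 Δ[p + 1])) ⊗ₜ
          simplexChain F (SSet.yonedaEquiv (𝟙 Δ[q + 1])))) := by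
      rw [fundamentalChain_succ_succ]
      apply boundary_cone
      -- The faces have total degree one lower, so induction moves the boundary inside `cross`,
      -- where the tensor boundary squares to zero.
      · rw [← map_zero (cross F _ _), ← tensorBoundary_tensorBoundary F (simplexChain F
          (SSet.yonedaEquiv (𝟙 Δ[p + 1])) ⊗ₜ simplexChain F (SSet.yonedaEquiv (𝟙 Δ[q + 1])))]
        have h₁ := boundary_cross_simplexChain p (q + 1) (S := Δ[p + 1]) (Y := Δ[q + 1])
        have h₂ := boundary_cross_simplexChain (p + 1) q (S := Δ[p + 1]) (Y := Δ[q + 1])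
        rw [tensorBoundary_tmul, boundary_yonedaEquiv_id, boundary_yonedaEquiv_id,
          signOp_simplexChain]
        simp only [TensorProduct.sum_tmul, TensorProduct.tmul_sum, map_sum, map_add,
          ← TensorProduct.smul_tmul', TensorProduct.tmul_smul, map_smul, h₁, h₂]
      · rw [tensorBoundary_tmul, boundary_yonedaEquiv_id, boundary_yonedaEquiv_id,
          signOp_simplexChain]
        simp only [TensorProduct.sum_tmul, TensorProduct.tmul_sum, map_sum, map_add,
          ← TensorProduct.smul_tmul', TensorProduct.tmul_smul, map_smul]
        rw [Finset.sum_eq_zero, Finset.sum_eq_zero, add_zero]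
        · intro i _
          rw [augmentation_cross_simplexChain F (by omega), smul_zero, smul_zero]
        · intro i _
          rw [augmentation_cross_simplexChain F (by omega), smul_zero]
    rw [cross_simplexChain, boundary_chainsMap, key, chainsMap_cross,
      ← tensorBoundary_map_chainsMap, TensorProduct.map_tmul, chainsMap_yonedaEquiv_symm,
      chainsMap_yonedaEquiv_symm]
termination_by p + q

/-- The boundary of a cross product. -/
theorem boundary_cross (t : Chains F S ⊗[F] Chains F Y) :
    boundary F _ (cross F S Y t) = cross F S Y (tensorBoundary F S Y t) := by
  exact LinearMap.congr_fun (f := boundary F _ ∘ₗ cross F S Y)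
    (g := cross F S Y ∘ₗ tensorBoundary F S Y)
    (tensor_hom_ext fun p x q y => boundary_cross_simplexChain F p q x y) t

/-! ### The Alexander-Whitney map -/

/-- The map `⦋m⦌ ⟶ ⦋n⦌` given by `i ↦ a + i`, truncated at `n`. -/
def window (a m n : ℕ) : ⦋m⦌ ⟶ ⦋n⦌ :=
  SimplexCategory.mkHom
    -- Truncation makes the map total in `a`, `m`, `n`; the Alexander-Whitney formula only uses
    -- windows with a + m ≤ n, where it has no effect.
    ⟨fun i => ⟨min (a + i) n, by omega⟩, fun i j h => by
      have : (i : ℕ) ≤ j := h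
      simp only [Fin.mk_le_mk]
      omega⟩

/-- The `m`-dimensional face of `x` with consecutive vertices starting from the vertex `a`. -/
def windowFace (a m : ℕ) {n : ℕ} (x : S _⦋n⦌) : S _⦋m⦌ := S.map (window a m n).op x

theorem windowFace_naturality (f : S ⟶ Y) (a m : ℕ) {n : ℕ} (x : S _⦋n⦌) :
    windowFace a m (f.app _ x) = f.app _ (windowFace a m x) :=
  (NatTrans.naturality_apply f (window a m n).op x).symm

theorem windowFace_self {n : ℕ} (x : S _⦋n⦌) : windowFace 0 n x = x := by
  have : window 0 n n = 𝟙 _ := by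
    ext i
    have := i.2
    simp [window] at this ⊢
    omega
  rw [windowFace, this, op_id, Functor.map_id_apply]

theorem δ_apply_val {n : ℕ} (i : Fin (n + 2)) (k : Fin (n + 1)) :
    (((SimplexCategory.δ i : ⦋n⦌ ⟶ ⦋n + 1⦌) k : Fin (n + 2)) : ℕ) =
      if (k : ℕ) < i then (k : ℕ) else k + 1 := by
  change ((i.succAbove k : Fin (n + 2)) : ℕ) = _
  rw [Fin.succAbove]
  split_ifs <;> simp_all [Fin.lt_def]

theorem window_apply_val (a m n : ℕ) (k : Fin (m + 1)) :
    ((window a m n k : Fin (n + 1)) : ℕ) = min (a + k) n := rfl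

/-- A vertex deleted before the window shifts it by one. The next two lemmas treat a vertex deleted
after the window or inside it. -/
theorem windowFace_δ_of_le {a m n : ℕ} (x : S _⦋n + 1⦌) (i : Fin (n + 2)) (h : (i : ℕ) ≤ a)
    (hn : a ≤ n) : windowFace a m (S.δ i x) = windowFace (a + 1) m x := by
  have : window a m n ≫ SimplexCategory.δ i = window (a + 1) m (n + 1) := by
    ext k
    change (((SimplexCategory.δ i : ⦋n⦌ ⟶ ⦋n + 1⦌) (window a m n k) : Fin (n + 2)) : ℕ) =
      (window (a + 1) m (n + 1) k : ℕ)
    rw [δ_apply_val, window_apply_val, window_apply_val]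
    split_ifs <;> omega
  rw [windowFace, windowFace, ← this, op_comp, Functor.map_comp_apply]
  rfl

theorem windowFace_δ_of_gt {a m n : ℕ} (x : S _⦋n + 1⦌) (i : Fin (n + 2)) (h : a + m < i) :
    windowFace a m (S.δ i x) = windowFace a m x := by
  have : window a m n ≫ SimplexCategory.δ i = window a m (n + 1) := by
    ext k
    change (((SimplexCategory.δ i : ⦋n⦌ ⟶ ⦋n + 1⦌) (window a m n k) : Fin (n + 2)) : ℕ) =
      (window a m (n + 1) k : ℕ)
    rw [δ_apply_val, window_apply_val, window_apply_val]
    have : (k : ℕ) < m + 1 := k.2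
    have := i.2
    split_ifs <;> omega
  rw [windowFace, windowFace, ← this, op_comp, Functor.map_comp_apply]
  rfl

theorem δ_windowFace {a m n : ℕ} (x : S _⦋n + 1⦌) (j : Fin (m + 2)) (i : Fin (n + 2))
    (hn : a + m ≤ n) (h : a + (j : ℕ) = i) :
    S.δ j (windowFace a (m + 1) x) = windowFace a m (S.δ i x) := by
  have : SimplexCategory.δ j ≫ window a (m + 1) (n + 1) =
      window a m n ≫ SimplexCategory.δ i := by
    ext k
    change (window a (m + 1) (n + 1) ((SimplexCategory.δ j : ⦋m⦌ ⟶ ⦋m + 1⦌) k) : ℕ) =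
      (((SimplexCategory.δ i : ⦋n⦌ ⟶ ⦋n + 1⦌) (window a m n k) : Fin (n + 2)) : ℕ)
    rw [δ_apply_val, window_apply_val, window_apply_val, δ_apply_val]
    have : (k : ℕ) < m + 1 := k.2
    split_ifs <;> omega
  have h' := congrArg (fun f => S.map f.op x) this
  simp only [op_comp, Functor.map_comp_apply] at h'
  exact h'

theorem δ_zero_windowFace {a m n : ℕ} (x : S _⦋n⦌) :
    S.δ 0 (windowFace a (m + 1) x) = windowFace (a + 1) m x := by
  have : SimplexCategory.δ 0 ≫ window a (m + 1) n = window (a + 1) m n := by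
    ext k
    change (window a (m + 1) n ((SimplexCategory.δ 0 : ⦋m⦌ ⟶ ⦋m + 1⦌) k) : ℕ) =
      (window (a + 1) m n k : ℕ)
    rw [window_apply_val, window_apply_val, δ_apply_val]
    rw [if_neg (by simp)]
    omega
  rw [windowFace, windowFace, ← this, op_comp, Functor.map_comp_apply]
  rfl

theorem δ_last_windowFace {a m n : ℕ} (x : S _⦋n⦌) :
    S.δ (Fin.last (m + 1)) (windowFace a (m + 1) x) = windowFace a m x := by
  have : SimplexCategory.δ (Fin.last (m + 1)) ≫ window a (m + 1) n = window a m n := by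
    ext k
    change (window a (m + 1) n
      ((SimplexCategory.δ (Fin.last (m + 1)) : ⦋m⦌ ⟶ ⦋m + 1⦌) k) : ℕ) = (window a m n k : ℕ)
    rw [window_apply_val, window_apply_val, δ_apply_val]
    have : (k : ℕ) < m + 1 := k.2
    simp only [Fin.val_last]
    split_ifs <;> omega
  rw [windowFace, windowFace, ← this, op_comp, Functor.map_comp_apply]
  rfl

/-- The Alexander-Whitney map. -/
noncomputable def alexanderWhitney (S Y : SSet.{w}) :
    Chains F (S ⊗ Y) →ₗ[F] Chains F S ⊗[F] Chains F Y :=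
  chainsLift F (S := S ⊗ Y) fun n z => ∑ pq ∈ Finset.HasAntidiagonal.antidiagonal n,
    simplexChain F (windowFace (S := S) 0 pq.1 z.1) ⊗ₜ
      simplexChain F (windowFace (S := Y) pq.1 pq.2 z.2)

theorem alexanderWhitney_simplexChain {n : ℕ} (z : (S ⊗ Y) _⦋n⦌) :
    alexanderWhitney F S Y (simplexChain F z) = ∑ pq ∈ Finset.HasAntidiagonal.antidiagonal n,
      simplexChain F (windowFace (S := S) 0 pq.1 z.1) ⊗ₜ
        simplexChain F (windowFace (S := Y) pq.1 pq.2 z.2) := by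
  exact chainsLift_simplexChain F _ z

theorem alexanderWhitney_chainsMap (f : S ⟶ S') (g : Y ⟶ Y') (c : Chains F (S ⊗ Y)) :
    alexanderWhitney F S' Y' (chainsMap F (f ⊗ₘ g) c) =
      TensorProduct.map (chainsMap F f) (chainsMap F g) (alexanderWhitney F S Y c) := by
  refine LinearMap.congr_fun (f := alexanderWhitney F S' Y' ∘ₗ chainsMap F (f ⊗ₘ g))
    (g := TensorProduct.map (chainsMap F f) (chainsMap F g) ∘ₗ alexanderWhitney F S Y)
    (Chains.hom_ext fun n z => ?_) c
  simp only [LinearMap.comp_apply, chainsMap_simplexChain, alexanderWhitney_simplexChain,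
    map_sum, TensorProduct.map_tmul]
  refine Finset.sum_congr rfl fun pq _ => ?_
  rw [← windowFace_naturality, ← windowFace_naturality]
  rfl

/-- Deleting a vertex i ≤ p shortens the front face, deleting i > p the back face. The two leftover
terms, the last face in front and the zeroth face behind, are the same tensor with signs (-1)^(p+1)
and (-1)^p, and cancel. -/
theorem sum_window_faces {p q n : ℕ} (hn : p + q = n) (x : S _⦋n + 1⦌) (y : Y _⦋n + 1⦌) :
    boundary F S (simplexChain F (windowFace 0 (p + 1) x)) ⊗ₜ[F]
          simplexChain F (windowFace (p + 1) q y) +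
        signOp F S (simplexChain F (windowFace 0 p x)) ⊗ₜ[F]
          boundary F Y (simplexChain F (windowFace p (q + 1) y)) =
      ∑ i : Fin (n + 2), (-1 : F) ^ (i : ℕ) •
        (simplexChain F (windowFace 0 p (S.δ i x)) ⊗ₜ[F]
          simplexChain F (windowFace p q (Y.δ i y))) := by
  rw [← (finCongr (show p + 1 + (q + 1) = n + 2 by omega)).sum_comp, Fin.sum_univ_add,
    boundary_simplexChain_succ, boundary_simplexChain_succ, Fin.sum_univ_castSucc,
    Fin.sum_univ_succ (n := q + 1), signOp_simplexChain, δ_last_windowFace, δ_zero_windowFace]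
  have h₁ : ∀ i : Fin (p + 1), S.δ i.castSucc (windowFace 0 (p + 1) x) =
      windowFace 0 p (S.δ (finCongr (show p + 1 + (q + 1) = n + 2 by omega)
        (Fin.castAdd (q + 1) i)) x) := fun i =>
    δ_windowFace x _ _ (by omega) (by simp)
  have h₂ : ∀ i : Fin (p + 1), windowFace (p + 1) q y =
      windowFace p q (Y.δ (finCongr (show p + 1 + (q + 1) = n + 2 by omega)
        (Fin.castAdd (q + 1) i)) y) := fun i =>
    (windowFace_δ_of_le y _ (by simp; omega) (by omega)).symm
  have h₃ : ∀ i : Fin (q + 1), Y.δ i.succ (windowFace p (q + 1) y) =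
      windowFace p q (Y.δ (finCongr (show p + 1 + (q + 1) = n + 2 by omega)
        (Fin.natAdd (p + 1) i)) y) := fun i =>
    δ_windowFace y _ _ (by omega) (by simp; omega)
  have h₄ : ∀ i : Fin (q + 1), windowFace 0 p x =
      windowFace 0 p (S.δ (finCongr (show p + 1 + (q + 1) = n + 2 by omega)
        (Fin.natAdd (p + 1) i)) x) := fun i =>
    (windowFace_δ_of_gt x _ (by simp; omega)).symm
  have e₁ : (∑ i : Fin (p + 1), (-1 : F) ^ (i.castSucc : ℕ) •
      simplexChain F (S.δ i.castSucc (windowFace 0 (p + 1) x))) ⊗ₜ[F]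
        simplexChain F (windowFace (p + 1) q y) =
      ∑ i : Fin (p + 1), (-1 : F) ^ (finCongr (show p + 1 + (q + 1) = n + 2 by omega)
        (Fin.castAdd (q + 1) i) : ℕ) •
        (simplexChain F (windowFace 0 p (S.δ (finCongr (show p + 1 + (q + 1) = n + 2 by omega)
        (Fin.castAdd (q + 1) i)) x)) ⊗ₜ[F]
          simplexChain F (windowFace p q (Y.δ (finCongr (show p + 1 + (q + 1) = n + 2 by omega)
        (Fin.castAdd (q + 1) i)) y))) := by
    rw [TensorProduct.sum_tmul]
    refine Finset.sum_congr rfl fun i _ => ?_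
    rw [← TensorProduct.smul_tmul', h₁ i, h₂ i]
    rfl
  have e₂ : ((-1 : F) ^ p • simplexChain F (windowFace 0 p x)) ⊗ₜ[F]
      (∑ i : Fin (q + 1), (-1 : F) ^ (i.succ : ℕ) •
        simplexChain F (Y.δ i.succ (windowFace p (q + 1) y))) =
      ∑ i : Fin (q + 1), (-1 : F) ^ (finCongr (show p + 1 + (q + 1) = n + 2 by omega)
        (Fin.natAdd (p + 1) i) : ℕ) •
        (simplexChain F (windowFace 0 p (S.δ (finCongr (show p + 1 + (q + 1) = n + 2 by omega)
        (Fin.natAdd (p + 1) i)) x)) ⊗ₜ[F]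
          simplexChain F (windowFace p q (Y.δ (finCongr (show p + 1 + (q + 1) = n + 2 by omega)
        (Fin.natAdd (p + 1) i)) y))) := by
    rw [TensorProduct.tmul_sum]
    refine Finset.sum_congr rfl fun i _ => ?_
    rw [← TensorProduct.smul_tmul', TensorProduct.tmul_smul, smul_smul, h₃ i, ← h₄ i, ← pow_add]
    congr 2
    simp; omega
  rw [← e₁, ← e₂, TensorProduct.add_tmul, TensorProduct.tmul_add]
  simp only [Fin.val_last, Fin.val_zero, pow_zero, one_smul, pow_succ, mul_neg, mul_one, neg_smul,
    TensorProduct.neg_tmul]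
  abel

theorem alexanderWhitney_boundary (c : Chains F (S ⊗ Y)) :
    alexanderWhitney F S Y (boundary F _ c) = tensorBoundary F S Y (alexanderWhitney F S Y c) := by
  refine LinearMap.congr_fun (f := alexanderWhitney F S Y ∘ₗ boundary F _)
    (g := tensorBoundary F S Y ∘ₗ alexanderWhitney F S Y)
    (Chains.hom_ext fun n z => ?_) c
  simp only [LinearMap.comp_apply]
  cases n with
  | zero => simp [alexanderWhitney_simplexChain, tensorBoundary_tmul]
  | succ n =>
    simp only [boundary_simplexChain_succ, map_sum, map_smul, alexanderWhitney_simplexChain,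
      Finset.smul_sum, tensorBoundary_tmul]
    -- The front boundary vanishes at p = 0 and the back boundary at q = 0. Splitting off these ends
    -- shifts the two sums against each other, so that neighbouring terms pair up as in
    -- `sum_window_faces`.
    rw [Finset.sum_comm, Finset.sum_add_distrib, Finset.Nat.sum_antidiagonal_succ,
      Finset.Nat.sum_antidiagonal_succ' (n := n) (f := fun pq => signOp F S _ ⊗ₜ[F] _)]
    simp only [boundary_simplexChain_zero, TensorProduct.zero_tmul, TensorProduct.tmul_zero,
      zero_add]
    rw [← Finset.sum_add_distrib]
    refine Finset.sum_congr rfl fun pq h => ?_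
    exact (sum_window_faces F (Finset.HasAntidiagonal.mem_antidiagonal.mp h) (S := S) (Y := Y) z.1 z.2).symm

/-! ### The Eilenberg-Zilber homotopy -/

/-- The morphism from a standard simplex classifying a simplex. -/
abbrev classifyingMap {n : ℕ} (x : S _⦋n⦌) : Δ[n] ⟶ S := SSet.yonedaEquiv.symm x

/-- The composition of the Alexander-Whitney map with the cross product. -/
noncomputable def crossAW (S Y : SSet.{w}) : Chains F (S ⊗ Y) →ₗ[F] Chains F (S ⊗ Y) :=
  cross F S Y ∘ₗ alexanderWhitney F S Y

theorem crossAW_chainsMap (f : S ⟶ S') (g : Y ⟶ Y') (c : Chains F (S ⊗ Y)) :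
    crossAW F S' Y' (chainsMap F (f ⊗ₘ g) c) = chainsMap F (f ⊗ₘ g) (crossAW F S Y c) := by
  rw [crossAW, crossAW, LinearMap.comp_apply, LinearMap.comp_apply, alexanderWhitney_chainsMap,
    chainsMap_cross]

theorem boundary_crossAW (c : Chains F (S ⊗ Y)) :
    boundary F _ (crossAW F S Y c) = crossAW F S Y (boundary F _ c) := by
  rw [crossAW, LinearMap.comp_apply, LinearMap.comp_apply, alexanderWhitney_boundary,
    boundary_cross]

theorem crossAW_vertex (z : (S ⊗ Y) _⦋0⦌) :
    crossAW F S Y (simplexChain F z) = simplexChain F z := by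
  rw [crossAW, LinearMap.comp_apply, alexanderWhitney_simplexChain]
  rw [Finset.HasAntidiagonal.antidiagonal_zero, Finset.sum_singleton, windowFace_self,
    windowFace_self, cross_vertex_right, chainsMap_simplexChain]
  congr 1
  exact Prod.ext rfl (const_app_zero (S := Y) (Y := S) z.2 z.1)

theorem augmentation_crossAW {n : ℕ} (z : (S ⊗ Y) _⦋n + 1⦌) :
    augmentation F _ (crossAW F S Y (simplexChain F z)) = 0 := by
  rw [crossAW, LinearMap.comp_apply, alexanderWhitney_simplexChain, map_sum, map_sum]
  refine Finset.sum_eq_zero fun pq h => augmentation_cross_simplexChain F ?_ _ _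
  have := Finset.HasAntidiagonal.mem_antidiagonal.mp h
  omega

/-- The diagonal simplex of the square of a standard simplex. -/
def diagonalSimplex (n : ℕ) : (Δ[n] ⊗ Δ[n] : SSet.{w}) _⦋n⦌ :=
  (SSet.yonedaEquiv (𝟙 Δ[n]), SSet.yonedaEquiv (𝟙 Δ[n]))

theorem chainsMap_diagonalSimplex {n : ℕ} (z : (S ⊗ Y) _⦋n⦌) :
    chainsMap F (classifyingMap (S := S) z.1 ⊗ₘ classifyingMap (S := Y) z.2)
      (simplexChain F (diagonalSimplex n)) = simplexChain F z := by
  rw [chainsMap_simplexChain]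
  congr 1
  exact Prod.ext (SSet.yonedaEquiv_symm_app_id (X := S) z.1)
    (SSet.yonedaEquiv_symm_app_id (X := Y) z.2)

/-- The universal chains defining the homotopy from the identity to `crossAW`. -/
noncomputable def homotopyChain (n : ℕ) : Chains F (Δ[n] ⊗ Δ[n] : SSet.{w}) :=
  match n with
  | 0 => 0
  | n + 1 => cone F (n + 1) (n + 1)
      -- The homotopy equation prescribes the boundary as `crossAW` minus the identity minus the
      -- homotopy of the boundary; the last term is written by naturality through the faces.
      (crossAW F _ _ (simplexChain F (diagonalSimplex (n + 1))) -
        simplexChain F (diagonalSimplex (n + 1)) -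
        ∑ i : Fin (n + 2), (-1 : F) ^ (i : ℕ) •
          chainsMap F (SSet.stdSimplex.δ i ⊗ₘ SSet.stdSimplex.δ i) (homotopyChain n))

/-- The homotopy from the identity to `crossAW`. -/
noncomputable def ezHomotopy (S Y : SSet.{w}) : Chains F (S ⊗ Y) →ₗ[F] Chains F (S ⊗ Y) :=
  chainsLift F (S := S ⊗ Y) fun n z =>
    chainsMap F (classifyingMap (S := S) z.1 ⊗ₘ classifyingMap (S := Y) z.2)
      (homotopyChain F n)

theorem ezHomotopy_simplexChain {n : ℕ} (z : (S ⊗ Y) _⦋n⦌) :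
    ezHomotopy F S Y (simplexChain F z) =
      chainsMap F (classifyingMap (S := S) z.1 ⊗ₘ classifyingMap (S := Y) z.2)
        (homotopyChain F n) :=
  chainsLift_simplexChain F _ z

theorem ezHomotopy_chainsMap (f : S ⟶ S') (g : Y ⟶ Y') (c : Chains F (S ⊗ Y)) :
    ezHomotopy F S' Y' (chainsMap F (f ⊗ₘ g) c) =
      chainsMap F (f ⊗ₘ g) (ezHomotopy F S Y c) := by
  refine LinearMap.congr_fun (f := ezHomotopy F S' Y' ∘ₗ chainsMap F (f ⊗ₘ g))
    (g := chainsMap F (f ⊗ₘ g) ∘ₗ ezHomotopy F S Y) (Chains.hom_ext fun n z => ?_) c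
  simp only [LinearMap.comp_apply, chainsMap_simplexChain, ezHomotopy_simplexChain,
    ← chainsMap_comp_apply, tensorHom_comp_tensorHom, SSet.yonedaEquiv_symm_comp]
  rfl

theorem boundary_diagonalSimplex (n : ℕ) :
    boundary F _ (simplexChain F (diagonalSimplex.{w} (n + 1))) =
      ∑ i : Fin (n + 2), (-1 : F) ^ (i : ℕ) •
        chainsMap F (SSet.stdSimplex.δ i ⊗ₘ SSet.stdSimplex.δ i)
          (simplexChain F (diagonalSimplex n)) := by
  rw [boundary_simplexChain_succ]
  simp only [chainsMap_simplexChain]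
  rfl

theorem homotopyChain_eq (n : ℕ) : homotopyChain.{u, w} F n =
    ezHomotopy F _ _ (simplexChain F (diagonalSimplex n)) := by
  rw [ezHomotopy_simplexChain]
  simp [diagonalSimplex]

theorem homotopyChain_succ (n : ℕ) : homotopyChain.{u, w} F (n + 1) =
    cone F (n + 1) (n + 1)
      (crossAW F _ _ (simplexChain F (diagonalSimplex (n + 1))) -
        simplexChain F (diagonalSimplex (n + 1)) -
        ezHomotopy F _ _ (boundary F _ (simplexChain F (diagonalSimplex (n + 1))))) := by
  rw [homotopyChain, boundary_diagonalSimplex]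
  simp only [map_sum, map_smul, ezHomotopy_chainsMap, ← homotopyChain_eq]

theorem augmentation_homotopyChain (n : ℕ) :
    augmentation F _ (homotopyChain.{u, w} F n) = 0 := by
  cases n with
  | zero => simp [homotopyChain]
  | succ n => simp [homotopyChain]

theorem augmentation_ezHomotopy (c : Chains F (S ⊗ Y)) :
    augmentation F _ (ezHomotopy F S Y c) = 0 := by
  refine LinearMap.congr_fun (f := augmentation F _ ∘ₗ ezHomotopy F S Y)
    (g := 0) (Chains.hom_ext fun n z => ?_) c
  rw [LinearMap.comp_apply, ezHomotopy_simplexChain, augmentation_chainsMap,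
    augmentation_homotopyChain, LinearMap.zero_apply]

/-- Every simplex of a product is the image of a diagonal simplex, so naturality reduces to that
model. There induction shows that the prescribed boundary is a cycle, and the cone fills it. -/
theorem boundary_ezHomotopy_simplexChain (n : ℕ) {S Y : SSet.{w}} (z : (S ⊗ Y) _⦋n⦌) :
    boundary F _ (ezHomotopy F S Y (simplexChain F z)) =
      crossAW F S Y (simplexChain F z) - simplexChain F z -
        ezHomotopy F S Y (boundary F _ (simplexChain F z)) := by
  induction n generalizing S Y with
  | zero =>
    rw [ezHomotopy_simplexChain, crossAW_vertex, boundary_simplexChain_zero]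
    simp [homotopyChain]
  | succ n ih =>
    have ih' : boundary F _ (ezHomotopy F _ _ (boundary F _
        (simplexChain F (diagonalSimplex.{w} (n + 1))))) =
        crossAW F _ _ (boundary F _ (simplexChain F (diagonalSimplex.{w} (n + 1)))) -
          boundary F _ (simplexChain F (diagonalSimplex.{w} (n + 1))) -
          ezHomotopy F _ _ (boundary F _ (boundary F _
            (simplexChain F (diagonalSimplex.{w} (n + 1))))) := by
      rw [boundary_simplexChain_succ]
      simp only [map_sum, map_smul, ih, smul_sub, Finset.sum_sub_distrib]
    have key : boundary F _ (homotopyChain.{u, w} F (n + 1)) =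
        crossAW F _ _ (simplexChain F (diagonalSimplex (n + 1))) -
          simplexChain F (diagonalSimplex (n + 1)) -
          ezHomotopy F _ _ (boundary F _ (simplexChain F (diagonalSimplex (n + 1)))) := by
      rw [homotopyChain_succ]
      apply boundary_cone
      · rw [map_sub, map_sub, ih', boundary_crossAW, boundary_boundary, map_zero, sub_zero,
          sub_self]
      · rw [map_sub, map_sub, augmentation_ezHomotopy, augmentation_crossAW,
          augmentation_simplexChain, if_neg (by omega), sub_zero, sub_zero]
    rw [ezHomotopy_simplexChain, boundary_chainsMap, key, map_sub, map_sub, ← crossAW_chainsMap,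
      ← ezHomotopy_chainsMap, ← boundary_chainsMap, chainsMap_diagonalSimplex]

/-- The cross product is a left homotopy inverse of the Alexander-Whitney map. -/
theorem boundary_ezHomotopy (c : Chains F (S ⊗ Y)) :
    boundary F _ (ezHomotopy F S Y c) =
      cross F S Y (alexanderWhitney F S Y c) - c - ezHomotopy F S Y (boundary F _ c) :=
  LinearMap.congr_fun (f := boundary F _ ∘ₗ ezHomotopy F S Y)
    (g := crossAW F S Y - LinearMap.id - ezHomotopy F S Y ∘ₗ boundary F _)
    (Chains.hom_ext fun n z => boundary_ezHomotopy_simplexChain F n z) c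

end SimplicialChains

/-! ### Splittings over a field and the Künneth theorem -/

namespace SimplicialChains

open CategoryTheory Simplicial MonoidalCategory CartesianMonoidalCategory

universe w

open scoped TensorProduct

section Components

variable (F : Type u) [CommRing F] {S : SSet.{w}}

/-- The projection of the total chain module onto its component of degree `n`. -/
noncomputable def component (S : SSet.{w}) (n : ℕ) : Chains F S →ₗ[F] Chains F S :=
  chainsLift F fun m x => if m = n then simplexChain F x else 0

theorem component_simplexChain {m : ℕ} (n : ℕ) (x : S _⦋m⦌) :
    component F S n (simplexChain F x) = if m = n then simplexChain F x else 0 :=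
  chainsLift_simplexChain F _ x

@[simp]
theorem component_simplexChain_self {n : ℕ} (x : S _⦋n⦌) :
    component F S n (simplexChain F x) = simplexChain F x := by
  rw [component_simplexChain, if_pos rfl]

theorem component_component (m n : ℕ) (c : Chains F S) :
    component F S m (component F S n c) = if m = n then component F S n c else 0 := by
  by_cases h : m = n
  · subst h
    rw [if_pos rfl]
    refine LinearMap.congr_fun (f := component F S m ∘ₗ component F S m)
      (g := component F S m) (Chains.hom_ext fun k x => ?_) c
    rw [LinearMap.comp_apply, component_simplexChain]
    split_ifs with hk
    · rw [component_simplexChain, if_pos hk]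
    · rw [map_zero]
  · rw [if_neg h]
    refine LinearMap.congr_fun (f := component F S m ∘ₗ component F S n)
      (g := 0) (Chains.hom_ext fun k x => ?_) c
    rw [LinearMap.comp_apply, component_simplexChain, LinearMap.zero_apply]
    split_ifs with hk
    · rw [component_simplexChain, if_neg (by omega)]
    · rw [map_zero]

theorem boundary_component (n : ℕ) (c : Chains F S) :
    boundary F S (component F S (n + 1) c) = component F S n (boundary F S c) := by
  suffices h : boundary F S ∘ₗ component F S (n + 1) = component F S n ∘ₗ boundary F S from
    LinearMap.congr_fun h c
  refine Chains.hom_ext fun m x => ?_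
  simp only [LinearMap.comp_apply]
  cases m with
  | zero => rw [component_simplexChain, if_neg (by omega), boundary_simplexChain_zero, map_zero,
      map_zero]
  | succ m =>
    by_cases h : m = n
    · rw [component_simplexChain, if_pos (by omega), boundary_simplexChain_succ, map_sum]
      refine Finset.sum_congr rfl fun i _ => ?_
      rw [map_smul, component_simplexChain, if_pos h]
    · rw [component_simplexChain, if_neg (by omega), boundary_simplexChain_succ, map_sum, map_zero]
      refine (Finset.sum_eq_zero fun i _ => ?_).symm
      rw [map_smul, component_simplexChain, if_neg h, smul_zero]

theorem signOp_component (n : ℕ) (c : Chains F S) :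
    signOp F S (component F S n c) = (-1 : F) ^ n • component F S n c := by
  refine LinearMap.congr_fun (f := signOp F S ∘ₗ component F S n)
    (g := (-1 : F) ^ n • component F S n) (Chains.hom_ext fun m x => ?_) c
  simp only [LinearMap.comp_apply, LinearMap.smul_apply, component_simplexChain]
  split_ifs with h
  · subst h
    exact signOp_simplexChain F x
  · rw [map_zero, smul_zero]

end Components

variable {F : Type u} [Field F] {S Y : SSet.{w}}

/-- Field coefficients enter here: the surjection onto the range has a linear section, which extends
to all of `W`. -/
theorem exists_generalized_inverse {V W : Type*} [AddCommGroup V] [Module F V] [AddCommGroup W]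
    [Module F W] (f : V →ₗ[F] W) : ∃ g : W →ₗ[F] V, ∀ v, f (g (f v)) = f v := by
  obtain ⟨g₀, hg₀⟩ := f.rangeRestrict.exists_rightInverse_of_surjective f.range_rangeRestrict
  obtain ⟨g, hg⟩ := g₀.exists_extend
  refine ⟨g, fun v => ?_⟩
  have h₁ := LinearMap.congr_fun hg (f.rangeRestrict v)
  have h₂ := congrArg Subtype.val (LinearMap.congr_fun hg₀ (f.rangeRestrict v))
  simp only [LinearMap.comp_apply, Submodule.subtype_apply, LinearMap.codRestrict_apply,
    LinearMap.id_apply, LinearMap.rangeRestrict] at h₁ h₂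
  rw [h₁]
  exact h₂

/-- A graded generalized inverse of the boundary operator. -/
structure ChainSplitting (F : Type u) [Field F] (S : SSet.{w}) where
  /-- The underlying operator of degree one. -/
  op : Chains F S →ₗ[F] Chains F S
  boundary_op_boundary : ∀ c, boundary F S (op (boundary F S c)) = boundary F S c
  signOp_op : ∀ c, signOp F S (op c) = - op (signOp F S c)
  op_component : ∀ n c, op (component F S n c) = component F S (n + 1) (op c)

/-- An arbitrary generalized inverse need not be graded. Keeping only its degree n + 1 part on
n-simplices preserves the identity ∂t∂ = ∂, because ∂ is homogeneous. -/
instance : Nonempty (ChainSplitting F S) := by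
  obtain ⟨g, hg⟩ := exists_generalized_inverse (boundary F S)
  let t : Chains F S →ₗ[F] Chains F S :=
    chainsLift F fun n x => component F S (n + 1) (g (simplexChain F x))
  have ht : ∀ {n : ℕ} (x : S _⦋n⦌),
      t (simplexChain F x) = component F S (n + 1) (g (simplexChain F x)) := fun x =>
    chainsLift_simplexChain F _ x
  refine ⟨⟨t, fun c => ?_, fun c => ?_, fun n c => ?_⟩⟩
  · refine LinearMap.congr_fun (f := boundary F S ∘ₗ t ∘ₗ boundary F S)
      (g := boundary F S) (Chains.hom_ext fun n x => ?_) c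
    rw [LinearMap.comp_apply, LinearMap.comp_apply]
    cases n with
    | zero => simp
    | succ n =>
      have h : t (boundary F S (simplexChain F x)) =
          component F S (n + 1) (g (boundary F S (simplexChain F x))) := by
        simp only [boundary_simplexChain_succ, map_sum, map_smul, ht]
      rw [h, boundary_component, hg, ← boundary_component, component_simplexChain_self]
  · refine LinearMap.congr_fun (f := signOp F S ∘ₗ t)
      (g := - (t ∘ₗ signOp F S)) (Chains.hom_ext fun n x => ?_) c
    rw [LinearMap.comp_apply, LinearMap.neg_apply, LinearMap.comp_apply, signOp_simplexChain,
      map_smul, ht, signOp_component, pow_succ, mul_neg_one, neg_smul]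
  · refine LinearMap.congr_fun (f := t ∘ₗ component F S n)
      (g := component F S (n + 1) ∘ₗ t) (Chains.hom_ext fun m x => ?_) c
    rw [LinearMap.comp_apply, LinearMap.comp_apply, component_simplexChain, ht,
      component_component]
    by_cases h : m = n
    · rw [if_pos h, if_pos (by omega), ht]
    · rw [if_neg h, if_neg (by omega), map_zero]

namespace ChainSplitting

variable (t : ChainSplitting F S) (t' : ChainSplitting F Y)

/-- The projection onto harmonic chains, homotopic to the identity. -/
noncomputable def proj : Chains F S →ₗ[F] Chains F S :=
  LinearMap.id - boundary F S ∘ₗ t.op - t.op ∘ₗ boundary F S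

theorem proj_apply (c : Chains F S) :
    t.proj c = c - boundary F S (t.op c) - t.op (boundary F S c) := rfl

theorem boundary_proj (c : Chains F S) : boundary F S (t.proj c) = 0 := by
  rw [proj_apply, map_sub, map_sub, boundary_boundary, t.boundary_op_boundary, sub_zero, sub_self]

theorem proj_boundary (c : Chains F S) : t.proj (boundary F S c) = 0 := by
  rw [proj_apply, boundary_boundary, t.boundary_op_boundary, map_zero, sub_self, sub_zero]

theorem signOp_proj (c : Chains F S) : signOp F S (t.proj c) = t.proj (signOp F S c) := by
  simp only [proj_apply, map_sub, signOp_boundary, t.signOp_op, map_neg, neg_neg]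

theorem component_proj (n : ℕ) (c : Chains F S) :
    component F S (n + 1) (t.proj c) = t.proj (component F S (n + 1) c) := by
  simp only [proj_apply, map_sub, t.op_component, boundary_component]

theorem proj_congr {c c' : Chains F S} (h : c - c' ∈ LinearMap.range (boundary F S)) :
    t.proj c = t.proj c' := by
  obtain ⟨b, hb⟩ := h
  rw [← sub_eq_zero, ← map_sub, ← hb, proj_boundary]

/-- The homotopy on the tensor product. -/
noncomputable def tensorHomotopy :
    Chains F S ⊗[F] Chains F Y →ₗ[F] Chains F S ⊗[F] Chains F Y :=
  TensorProduct.map t.op LinearMap.id + TensorProduct.map (t.proj ∘ₗ signOp F S) t'.op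

theorem tensorHomotopy_tmul (a : Chains F S) (b : Chains F Y) :
    tensorHomotopy t t' (a ⊗ₜ b) = t.op a ⊗ₜ b + t.proj (signOp F S a) ⊗ₜ t'.op b := rfl

/-- With P and P' the projections, 1 - P ⊗ P' = (1 - P) ⊗ 1 + P ⊗ (1 - P'), and each summand is
contracted by the splitting of one factor; the sign operator accounts for the Koszul sign. -/
theorem tensorBoundary_tensorHomotopy (c : Chains F S ⊗[F] Chains F Y) :
    tensorBoundary F S Y (tensorHomotopy t t' c) + tensorHomotopy t t' (tensorBoundary F S Y c) =
      c - TensorProduct.map t.proj t'.proj c := by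
  refine LinearMap.congr_fun
    (f := tensorBoundary F S Y ∘ₗ tensorHomotopy t t' + tensorHomotopy t t' ∘ₗ tensorBoundary F S Y)
    (g := LinearMap.id - TensorProduct.map t.proj t'.proj) (TensorProduct.ext' fun a b => ?_) c
  have h₁ : a = t.proj a + boundary F S (t.op a) + t.op (boundary F S a) := by
    rw [proj_apply]; abel
  have h₂ : t'.proj b = b - boundary F Y (t'.op b) - t'.op (boundary F Y b) := rfl
  simp only [LinearMap.add_apply, LinearMap.comp_apply, LinearMap.sub_apply, LinearMap.id_apply,
    TensorProduct.map_tmul, tensorBoundary_tmul, tensorHomotopy_tmul, map_add, t.signOp_op,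
    signOp_proj, signOp_signOp, boundary_proj, signOp_boundary, map_neg, proj_boundary,
    TensorProduct.neg_tmul, TensorProduct.zero_tmul, h₂, TensorProduct.tmul_sub]
  have h₃ : a ⊗ₜ[F] b = t.proj a ⊗ₜ[F] b + boundary F S (t.op a) ⊗ₜ[F] b +
      t.op (boundary F S a) ⊗ₜ[F] b := by
    rw [← TensorProduct.add_tmul, ← TensorProduct.add_tmul, ← h₁]
  rw [h₃]
  abel

theorem tmul_sub_proj_tmul_proj_mem {a : Chains F S} {b : Chains F Y} (ha : boundary F S a = 0)
    (hb : boundary F Y b = 0) :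
    a ⊗ₜ b - t.proj a ⊗ₜ t'.proj b ∈ LinearMap.range (tensorBoundary F S Y) := by
  refine ⟨tensorHomotopy t t' (a ⊗ₜ b), ?_⟩
  have := tensorBoundary_tensorHomotopy t t' (a ⊗ₜ b)
  rwa [tensorBoundary_tmul, ha, hb, TensorProduct.zero_tmul, TensorProduct.tmul_zero, add_zero,
    map_zero, add_zero, TensorProduct.map_tmul] at this

end ChainSplitting

/-- Every cycle of degree `n` is a boundary. -/
def IsAcyclicAt (F : Type u) [Field F] (S : SSet.{w}) (n : ℕ) : Prop :=
  ∀ c : Chains F S, component F S n c = c → boundary F S c = 0 →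
    c ∈ LinearMap.range (boundary F S)

theorem tmul_mem_range_tensorBoundary_left {a : Chains F S} {b : Chains F Y}
    (ha : a ∈ LinearMap.range (boundary F S)) (hb : boundary F Y b = 0) :
    a ⊗ₜ b ∈ LinearMap.range (tensorBoundary F S Y) := by
  obtain ⟨e, rfl⟩ := ha
  exact ⟨e ⊗ₜ b, by rw [tensorBoundary_tmul, hb, TensorProduct.tmul_zero, add_zero]⟩

theorem tmul_mem_range_tensorBoundary_right {a : Chains F S} {b : Chains F Y}
    (ha : boundary F S a = 0) (hb : b ∈ LinearMap.range (boundary F Y)) :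
    a ⊗ₜ b ∈ LinearMap.range (tensorBoundary F S Y) := by
  obtain ⟨e, rfl⟩ := hb
  refine ⟨signOp F S a ⊗ₜ e, ?_⟩
  have h : boundary F S (signOp F S a) = 0 := by
    rw [← neg_eq_zero, ← signOp_boundary, ha, map_zero]
  rw [tensorBoundary_tmul, signOp_signOp, h, TensorProduct.zero_tmul, zero_add]

/-- Simplex by simplex, the projections turn front and back faces into cycles, so an acyclic factor
kills each mixed term even when `z` is not a cycle. All vertices have the same projection, so the
extreme terms depend only on the images of `z` in the factors. -/
theorem map_proj_alexanderWhitney_mem (t : ChainSplitting F S) (t' : ChainSplitting F Y) {k : ℕ}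
    (hk : 0 < k) {x₀ : S _⦋0⦌} {y₀ : Y _⦋0⦌}
    (hx₀ : ∀ x : S _⦋0⦌, simplexChain F x - simplexChain F x₀ ∈ LinearMap.range (boundary F S))
    (hy₀ : ∀ y : Y _⦋0⦌, simplexChain F y - simplexChain F y₀ ∈ LinearMap.range (boundary F Y))
    (h : ∀ i, 0 < i → i < k → IsAcyclicAt F S i ∨ IsAcyclicAt F Y (k - i))
    {z : Chains F (S ⊗ Y)} (hz : component F _ k z = z) :
    TensorProduct.map t.proj t'.proj (alexanderWhitney F S Y z) -
      (t.proj (chainsMap F (fst S Y) z) ⊗ₜ t'.proj (simplexChain F y₀) +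
        t.proj (simplexChain F x₀) ⊗ₜ t'.proj (chainsMap F (snd S Y) z)) ∈
      LinearMap.range (tensorBoundary F S Y) := by
  rw [← hz]
  refine Chains.map_mem (f :=
    (TensorProduct.map t.proj t'.proj ∘ₗ alexanderWhitney F S Y -
      ((TensorProduct.mk F _ _).flip (t'.proj (simplexChain F y₀)) ∘ₗ t.proj ∘ₗ
          chainsMap F (fst S Y) +
        TensorProduct.mk F _ _ (t.proj (simplexChain F x₀)) ∘ₗ t'.proj ∘ₗ
          chainsMap F (snd S Y))) ∘ₗ component F _ k) (fun n w => ?_) z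
  rw [LinearMap.comp_apply, component_simplexChain]
  split_ifs with hn
  swap
  · rw [map_zero]
    exact Submodule.zero_mem _
  subst hn
  simp only [LinearMap.sub_apply, LinearMap.add_apply, LinearMap.comp_apply, LinearMap.flip_apply,
    TensorProduct.mk_apply, chainsMap_simplexChain, alexanderWhitney_simplexChain, map_sum,
    TensorProduct.map_tmul]
  have ht : ∀ x : S _⦋0⦌, t.proj (simplexChain F x) = t.proj (simplexChain F x₀) := fun x =>
    t.proj_congr (hx₀ x)
  have ht' : ∀ y : Y _⦋0⦌, t'.proj (simplexChain F y) = t'.proj (simplexChain F y₀) := fun y =>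
    t'.proj_congr (hy₀ y)
  set f : ℕ × ℕ → Chains F S ⊗[F] Chains F Y := fun pq =>
    t.proj (simplexChain F (windowFace (S := S) 0 pq.1 w.1)) ⊗ₜ[F]
      t'.proj (simplexChain F (windowFace (S := Y) pq.1 pq.2 w.2)) with hf
  have e₁ : t.proj (simplexChain F ((fst S Y).app _ w)) ⊗ₜ[F] t'.proj (simplexChain F y₀) =
      f (n, 0) := by
    simp only [hf, ht', windowFace_self]
    rfl
  have e₂ : t.proj (simplexChain F x₀) ⊗ₜ[F] t'.proj (simplexChain F ((snd S Y).app _ w)) =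
      f (0, n) := by
    simp only [hf, ht, windowFace_self]
    rfl
  have hsub : {(n, 0), (0, n)} ⊆ Finset.HasAntidiagonal.antidiagonal n := by
    intro pq hpq
    rw [Finset.HasAntidiagonal.mem_antidiagonal]
    simp only [Finset.mem_insert, Finset.mem_singleton] at hpq
    rcases hpq with rfl | rfl <;> simp
  -- The two extreme indices are distinct because the degree is positive.
  rw [e₁, e₂, ← Finset.sum_pair (by simp; omega), ← Finset.sum_sdiff_eq_sub hsub]
  refine Submodule.sum_mem _ fun pq hpq => ?_
  obtain ⟨p, q⟩ := pq
  simp only [Finset.mem_sdiff, Finset.HasAntidiagonal.mem_antidiagonal, Finset.mem_insert,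
    Finset.mem_singleton, Prod.mk.injEq] at hpq
  obtain ⟨p, rfl⟩ : ∃ p', p = p' + 1 := ⟨p - 1, by omega⟩
  obtain ⟨q, rfl⟩ : ∃ q', q = q' + 1 := ⟨q - 1, by omega⟩
  rcases h (p + 1) (by omega) (by omega) with h' | h'
  · refine tmul_mem_range_tensorBoundary_left (h' _ ?_ (t.boundary_proj _)) (t'.boundary_proj _)
    rw [t.component_proj, component_simplexChain_self]
  · rw [show n - (p + 1) = q + 1 by omega] at h'
    refine tmul_mem_range_tensorBoundary_right (t.boundary_proj _) (h' _ ?_ (t'.boundary_proj _))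
    rw [t'.component_proj, component_simplexChain_self]

/-- A Künneth theorem: if the middle terms of the Künneth decomposition vanish in degree `k`,
then the `k`-cycles of a product of connected simplicial sets come from the two factors. -/
theorem kunneth_of_acyclic {k : ℕ}
    (hk : 0 < k) {x₀ : S _⦋0⦌} {y₀ : Y _⦋0⦌}
    (hx₀ : ∀ x : S _⦋0⦌, simplexChain F x - simplexChain F x₀ ∈ LinearMap.range (boundary F S))
    (hy₀ : ∀ y : Y _⦋0⦌, simplexChain F y - simplexChain F y₀ ∈ LinearMap.range (boundary F Y))
    (h : ∀ i, 0 < i → i < k → IsAcyclicAt F S i ∨ IsAcyclicAt F Y (k - i))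
    {z : Chains F (S ⊗ Y)} (hz : component F _ k z = z) (hz' : boundary F _ z = 0) :
    z - (chainsMap F (fst S Y ≫ lift (𝟙 S) (SSet.const y₀)) z +
      chainsMap F (snd S Y ≫ lift (SSet.const x₀) (𝟙 Y)) z) ∈
      LinearMap.range (boundary F (S ⊗ Y)) := by
  obtain ⟨t⟩ : Nonempty (ChainSplitting F S) := inferInstance
  obtain ⟨t'⟩ : Nonempty (ChainSplitting F Y) := inferInstance
  have hfst : boundary F S (chainsMap F (fst S Y) z) = 0 := by
    rw [boundary_chainsMap, hz', map_zero]
  have hsnd : boundary F Y (chainsMap F (snd S Y) z) = 0 := by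
    rw [boundary_chainsMap, hz', map_zero]
  obtain ⟨a₁, h₁⟩ := map_proj_alexanderWhitney_mem t t' hk hx₀ hy₀ h hz
  obtain ⟨a₂, h₂⟩ := t.tmul_sub_proj_tmul_proj_mem t' hfst (boundary_simplexChain_zero F y₀)
  obtain ⟨a₃, h₃⟩ := t.tmul_sub_proj_tmul_proj_mem t' (boundary_simplexChain_zero F x₀) hsnd
  have h₄ := t.tensorBoundary_tensorHomotopy t' (alexanderWhitney F S Y z)
  rw [← alexanderWhitney_boundary, hz', map_zero, map_zero, add_zero] at h₄
  have h₅ := boundary_ezHomotopy F z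
  rw [hz', map_zero, sub_zero] at h₅
  rw [chainsMap_comp_apply, chainsMap_comp_apply, ← cross_vertex_left, ← cross_vertex_right]
  -- The homotopies are chained: `ezHomotopy` replaces `z` by the cross product of its
  -- Alexander-Whitney image, `tensorHomotopy` projects both factors, `a₁` discards the mixed terms,
  -- and `a₂`, `a₃` remove the projections from the extreme ones.
  refine ⟨cross F S Y (t.tensorHomotopy t' (alexanderWhitney F S Y z) + a₁ - a₂ - a₃) -
    ezHomotopy F S Y z, ?_⟩
  rw [map_sub, boundary_cross, h₅]
  simp only [map_add, map_sub, h₁, h₂, h₃, h₄]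
  abel

end SimplicialChains

/-! ### Comparison with the simplicial chain complex -/

namespace SimplicialChains

open CategoryTheory Simplicial MonoidalCategory CartesianMonoidalCategory Limits

universe w

open scoped TensorProduct

variable (F : Type u) [CommRing F]

theorem component_chainsMap {S Y : SSet.{w}} (f : S ⟶ Y) (n : ℕ) (c : Chains F S) :
    component F Y n (chainsMap F f c) = chainsMap F f (component F S n c) := by
  refine LinearMap.congr_fun (f := component F Y n ∘ₗ chainsMap F f)
    (g := chainsMap F f ∘ₗ component F S n) (Chains.hom_ext fun m x => ?_) c
  simp only [LinearMap.comp_apply, chainsMap_simplexChain, component_simplexChain]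
  split_ifs
  · rw [chainsMap_simplexChain]
  · rw [map_zero]

variable {S Y : SSet.{u}}

/-- A simplex, as an element of Mathlib's simplicial chain complex. -/
noncomputable def simplexElement {n : ℕ} (x : S _⦋n⦌) :
    (S.chainComplex (ModuleCat.of F F)).X n :=
  (S.ιChainComplex (R := ModuleCat.of F F) x).hom (1 : F)

variable {F} in
theorem chainComplex_linearMap_ext {n : ℕ} {V : Type u} [AddCommGroup V] [Module F V]
    {f g : (S.chainComplex (ModuleCat.of F F)).X n →ₗ[F] V}
    (h : ∀ x : S _⦋n⦌, f (simplexElement F x) = g (simplexElement F x)) : f = g := by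
  have : ModuleCat.ofHom f = ModuleCat.ofHom g :=
    SSet.chainComplex_hom_ext fun x => ModuleCat.hom_ext (LinearMap.ext_ring (h x))
  exact congrArg ModuleCat.Hom.hom this

theorem d_simplexElement {n : ℕ} (x : S _⦋n + 1⦌) :
    (S.chainComplex (ModuleCat.of F F)).d (n + 1) n (simplexElement F x) =
      ∑ i : Fin (n + 2), (-1 : F) ^ (i : ℕ) • simplexElement F (S.δ i x) := by
  have h := congrArg (fun f => f.hom (1 : F))
    (SSet.ιChainComplex_d (R := ModuleCat.of F F) S x)
  refine h.trans ?_
  simp only [ModuleCat.hom_sum, LinearMap.sum_apply]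
  refine Finset.sum_congr rfl fun i _ => ?_
  rw [ModuleCat.hom_zsmul, LinearMap.smul_apply, ← Int.cast_smul_eq_zsmul F, Int.cast_pow,
    Int.cast_neg, Int.cast_one]
  rfl

theorem chainComplexMap_simplexElement (f : S ⟶ Y) {n : ℕ} (x : S _⦋n⦌) :
    (SSet.chainComplexMap f (ModuleCat.of F F)).f n (simplexElement F x) =
      simplexElement F (f.app _ x) :=
  congrArg (fun g => g.hom (1 : F)) (SSet.ι_chainComplexMap_f S Y f (ModuleCat.of F F) x)

/-- The inclusion of the degree `n` part of the simplicial chain complex in the total chains. -/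
noncomputable def toChains (S : SSet.{u}) (n : ℕ) :
    (S.chainComplex (ModuleCat.of F F)).X n →ₗ[F] Chains F S :=
  ((S.isColimitChainComplexXCofan (ModuleCat.of F F) n).desc
    (Cofan.mk (ModuleCat.of F (Chains F S)) fun x =>
      ModuleCat.ofHom (LinearMap.toSpanSingleton F _ (simplexChain F x)))).hom

@[simp]
theorem toChains_simplexElement {n : ℕ} (x : S _⦋n⦌) :
    toChains F S n (simplexElement F x) = simplexChain F x := by
  have h := congrArg (fun f => f.hom (1 : F))
    ((S.isColimitChainComplexXCofan (ModuleCat.of F F) n).fac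
    (Cofan.mk (ModuleCat.of F (Chains F S)) fun x =>
      ModuleCat.ofHom (LinearMap.toSpanSingleton F _ (simplexChain F x))) ⟨x⟩)
  exact h.trans (one_smul F _)

/-- The projection of the total chains onto the degree `n` part of the chain complex. -/
noncomputable def ofChains (S : SSet.{u}) (n : ℕ) :
    Chains F S →ₗ[F] (S.chainComplex (ModuleCat.of F F)).X n :=
  chainsLift F fun m x => if h : m = n then simplexElement F (h ▸ x) else 0

theorem ofChains_simplexChain {n : ℕ} (x : S _⦋n⦌) :
    ofChains F S n (simplexChain F x) = simplexElement F x := by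
  rw [ofChains, chainsLift_simplexChain, dif_pos rfl]

theorem ofChains_simplexChain_of_ne {m n : ℕ} (h : m ≠ n) (x : S _⦋m⦌) :
    ofChains F S n (simplexChain F x) = 0 := by
  rw [ofChains, chainsLift_simplexChain, dif_neg h]

theorem ofChains_toChains {n : ℕ} (c : (S.chainComplex (ModuleCat.of F F)).X n) :
    ofChains F S n (toChains F S n c) = c := by
  suffices h : ofChains F S n ∘ₗ toChains F S n = LinearMap.id from LinearMap.congr_fun h c
  refine chainComplex_linearMap_ext fun x => ?_
  rw [LinearMap.comp_apply, toChains_simplexElement, ofChains_simplexChain, LinearMap.id_apply]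

theorem toChains_ofChains {n : ℕ} (c : Chains F S) :
    toChains F S n (ofChains F S n c) = component F S n c := by
  suffices h : toChains F S n ∘ₗ ofChains F S n = component F S n from LinearMap.congr_fun h c
  refine Chains.hom_ext fun m x => ?_
  rw [LinearMap.comp_apply, component_simplexChain]
  split_ifs with h
  · subst h
    rw [ofChains_simplexChain, toChains_simplexElement]
  · rw [ofChains_simplexChain_of_ne F h, map_zero]

theorem component_toChains {n : ℕ} (c : (S.chainComplex (ModuleCat.of F F)).X n) :
    component F S n (toChains F S n c) = toChains F S n c := by
  rw [← toChains_ofChains, ofChains_toChains]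

theorem boundary_toChains {n : ℕ} (c : (S.chainComplex (ModuleCat.of F F)).X (n + 1)) :
    boundary F S (toChains F S (n + 1) c) =
      toChains F S n ((S.chainComplex (ModuleCat.of F F)).d (n + 1) n c) := by
  suffices h : boundary F S ∘ₗ toChains F S (n + 1) =
      toChains F S n ∘ₗ ((S.chainComplex (ModuleCat.of F F)).d (n + 1) n).hom from
    LinearMap.congr_fun h c
  refine chainComplex_linearMap_ext fun x => ?_
  have h := d_simplexElement F x
  rw [LinearMap.comp_apply, toChains_simplexElement, LinearMap.comp_apply]
  erw [h]
  simp only [boundary_simplexChain_succ, map_sum, map_smul, toChains_simplexElement]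

theorem ofChains_boundary {n : ℕ} (c : Chains F S) :
    ofChains F S n (boundary F S c) =
      (S.chainComplex (ModuleCat.of F F)).d (n + 1) n (ofChains F S (n + 1) c) := by
  rw [← ofChains_toChains F ((S.chainComplex (ModuleCat.of F F)).d (n + 1) n _),
    ← boundary_toChains, toChains_ofChains, boundary_component, ← toChains_ofChains,
    ofChains_toChains]

theorem chainsMap_toChains (f : S ⟶ Y) {n : ℕ} (c : (S.chainComplex (ModuleCat.of F F)).X n) :
    chainsMap F f (toChains F S n c) =
      toChains F Y n ((SSet.chainComplexMap f (ModuleCat.of F F)).f n c) := by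
  suffices h : chainsMap F f ∘ₗ toChains F S n =
      toChains F Y n ∘ₗ ((SSet.chainComplexMap f (ModuleCat.of F F)).f n).hom from
    LinearMap.congr_fun h c
  refine chainComplex_linearMap_ext fun x => ?_
  have h := chainComplexMap_simplexElement F f x
  rw [LinearMap.comp_apply, toChains_simplexElement, LinearMap.comp_apply]
  erw [h]
  rw [chainsMap_simplexChain, toChains_simplexElement]

/-- Vertices in one component are linked by a zigzag of edges, and the boundary of an edge is the
difference of its ends. -/
theorem simplexChain_sub_mem_range_boundary [S.IsConnected] (x y : S _⦋0⦌) :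
    simplexChain F x - simplexChain F y ∈ LinearMap.range (boundary F S) := by
  have h := (SSet.π₀.mk_eq_mk_iff x y).mp (Subsingleton.elim _ _)
  induction h with
  | rel a b h =>
    obtain ⟨e⟩ := h
    -- The boundary of an edge is target minus source, hence the sign.
    refine ⟨-simplexChain F e.edge, ?_⟩
    rw [map_neg, boundary_simplexChain_succ, Fin.sum_univ_two]
    have h₁ : S.δ 1 e.edge = a := e.src_eq
    have h₂ : S.δ 0 e.edge = b := e.tgt_eq
    rw [h₁, h₂]
    simp [sub_eq_add_neg]
  | refl a => rw [sub_self]; exact Submodule.zero_mem _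
  | symm a b _ ih =>
    rw [← neg_sub]
    exact Submodule.neg_mem _ ih
  | trans a b c _ _ ih₁ ih₂ =>
    rw [← sub_add_sub_cancel _ (simplexChain F b)]
    exact Submodule.add_mem _ ih₁ ih₂

end SimplicialChains

/-! ### Homology of module complexes in terms of cycles -/

section ModuleComplexes

open CategoryTheory

variable {R : Type u} [Ring R] {K L : ChainComplex (ModuleCat.{v} R) ℕ}

theorem ChainComplex.exists_d_eq_of_subsingleton_homology {n : ℕ}
    [Subsingleton (K.homology (n + 1))] (c : K.X (n + 1)) (hc : K.d (n + 1) n c = 0) :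
    ∃ b : K.X (n + 2), K.d (n + 2) (n + 1) b = c := by
  have h : K.ExactAt (n + 1) := by
    rw [K.exactAt_iff_isZero_homology]
    exact ModuleCat.isZero_of_subsingleton _
  rw [K.exactAt_iff' (n + 2) (n + 1) n (by simp) (by simp),
    ShortComplex.moduleCat_exact_iff] at h
  exact h c hc

theorem ChainComplex.homologyMap_eq_zero_of_cycles (f : K ⟶ L) {n : ℕ}
    (h : ∀ c : K.X (n + 1), K.d (n + 1) n c = 0 →
      ∃ b : L.X (n + 2), L.d (n + 2) (n + 1) b = f.f (n + 1) c) :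
    HomologicalComplex.homologyMap f (n + 1) = 0 := by
  rw [← cancel_epi (K.homologyπ (n + 1)), HomologicalComplex.homologyπ_naturality, Limits.comp_zero]
  ext z
  obtain ⟨b, hb⟩ := h (K.iCycles (n + 1) z) (by
    rw [← ConcreteCategory.comp_apply, K.iCycles_d]; rfl)
  have hz : HomologicalComplex.cyclesMap f (n + 1) z = L.toCycles (n + 2) (n + 1) b := by
    apply (ModuleCat.mono_iff_injective (L.iCycles (n + 1))).mp inferInstance
    rw [← ConcreteCategory.comp_apply, ← ConcreteCategory.comp_apply, L.toCycles_i,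
      HomologicalComplex.cyclesMap_i, hb]
    rfl
  have h0 := ConcreteCategory.congr_hom (L.toCycles_comp_homologyπ (n + 2) (n + 1)) b
  rw [ConcreteCategory.comp_apply, ← hz] at h0
  exact h0

theorem Homotopy.exists_d_eq_sub {f g : K ⟶ L} (H : Homotopy f g) {n : ℕ} (c : K.X (n + 1))
    (hc : K.d (n + 1) n c = 0) :
    ∃ b : L.X (n + 2), L.d (n + 2) (n + 1) b = f.f (n + 1) c - g.f (n + 1) c := by
  refine ⟨H.hom (n + 1) (n + 2) c, ?_⟩
  have h := ConcreteCategory.congr_hom (H.comm (n + 1)) c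
  rw [Homotopy.prevD_chainComplex, Homotopy.dNext_succ_chainComplex] at h
  have h₁ : f.f (n + 1) c = H.hom n (n + 1) (K.d (n + 1) n c) +
    L.d (n + 2) (n + 1) (H.hom (n + 1) (n + 2) c) + g.f (n + 1) c := h
  rw [h₁, hc, map_zero, zero_add, add_sub_cancel_right]

end ModuleComplexes

/-! ### Singular simplicial sets -/

namespace SimplicialChains

open CategoryTheory Simplicial MonoidalCategory CartesianMonoidalCategory

variable {M X Z : Type u} [TopologicalSpace M] [TopologicalSpace X] [TopologicalSpace Z]

/-- The singular simplicial set of a topological space. -/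
noncomputable abbrev sing (M : Type u) [TopologicalSpace M] : SSet.{u} :=
  TopCat.toSSet.obj (TopCat.of M)

/-- The morphism of singular simplicial sets induced by a continuous map. -/
noncomputable abbrev singMap (f : C(M, X)) : sing M ⟶ sing X := TopCat.toSSet.map (TopCat.ofHom f)

/-- The morphism of singular simplicial sets induced by a continuous map of two variables. -/
noncomputable def singMap₂ (φ : C(M × X, Z)) : sing M ⊗ sing X ⟶ sing Z where
  app n := TypeCat.ofHom fun z : (sing M).obj n × (sing X).obj n =>
    ULift.up (TopCat.ofHom (φ.comp (z.1.down.hom.prodMk z.2.down.hom)))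
  naturality _ _ _ := rfl

/-- The vertex of the singular simplicial set given by a point. -/
noncomputable def singVertex (p : X) : sing X _⦋0⦌ :=
  ULift.up (TopCat.ofHom (ContinuousMap.const _ p))

end SimplicialChains

/-! ### Künneth and homotopy invariance for singular chains -/

namespace InvariantSection

open CategoryTheory Simplicial SimplicialChains

variable (F : Type u) [Field F] {M X Z : Type u} [TopologicalSpace M] [TopologicalSpace X]
  [TopologicalSpace Z]

theorem isAcyclicAt_of_subsingleton_H {n : ℕ} (h : Subsingleton (H F (n + 1) M)) :
    IsAcyclicAt F (sing M) (n + 1) := by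
  intro c hc hc'
  have h' : Subsingleton (((sing M).chainComplex (ModuleCat.of F F)).homology (n + 1)) := h
  obtain ⟨b, hb⟩ := ChainComplex.exists_d_eq_of_subsingleton_homology
    (K := (sing M).chainComplex (ModuleCat.of F F)) (ofChains F (sing M) (n + 1) c) (by
      rw [← ofChains_boundary, hc', map_zero])
  exact ⟨toChains F _ _ b, by rw [boundary_toChains, hb, toChains_ofChains, hc]⟩

theorem inducedMap_eq_zero {n : ℕ} (f : C(M, X))
    (h : ∀ c : Chains F (sing M), component F _ (n + 1) c = c → boundary F _ c = 0 →
      chainsMap F (singMap f) c ∈ LinearMap.range (boundary F (sing X))) :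
    inducedMap F (n + 1) f = 0 := by
  have key := ChainComplex.homologyMap_eq_zero_of_cycles
    (SSet.chainComplexMap (singMap f) (ModuleCat.of F F)) (n := n) fun c hc => by
      obtain ⟨b, hb⟩ := h (toChains F _ _ c) (component_toChains F c) (by
        rw [boundary_toChains, hc, map_zero])
      refine ⟨ofChains F _ _ b, ?_⟩
      rw [← ofChains_boundary, hb, chainsMap_toChains, ofChains_toChains]
  exact congrArg ModuleCat.Hom.hom key

theorem chainsMap_sub_mem_of_homotopic {f g : C(M, X)} (hfg : f.Homotopic g) {n : ℕ}
    {c : Chains F (sing M)} (hc : component F _ (n + 1) c = c) (hc' : boundary F _ c = 0) :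
    chainsMap F (singMap f) c - chainsMap F (singMap g) c ∈
      LinearMap.range (boundary F (sing X)) := by
  obtain ⟨H⟩ := hfg
  have H' : TopCat.Homotopy (TopCat.ofHom f) (TopCat.ofHom g) := H
  let K : Homotopy (SSet.chainComplexMap (singMap f) (ModuleCat.of F F))
    (SSet.chainComplexMap (singMap g) (ModuleCat.of F F)) :=
    H'.singularChainComplexFunctorObjMap (ModuleCat.of F F)
  obtain ⟨b, hb⟩ := K.exists_d_eq_sub (n := n) (ofChains F (sing M) (n + 1) c) (by
      have := ofChains_boundary F (n := n) c
      rw [hc', map_zero] at this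
      exact this.symm)
  refine ⟨toChains F _ _ b, ?_⟩
  rw [boundary_toChains, hb, map_sub, ← chainsMap_toChains, ← chainsMap_toChains,
    toChains_ofChains, hc]

/-- If the middle terms of the Künneth decomposition vanish, then the map induced in homology by
`x ↦ φ (x, σ x)` is the sum of those induced by the two restrictions of `φ`. -/
theorem chainsMap_diagonal_sub_mem [PathConnectedSpace M] [PathConnectedSpace X] {k : ℕ}
    (h : ∀ i : ℕ, 0 < i → i < k + 1 →
      Subsingleton (H F i M) ∨ Subsingleton (H F (k + 1 - i) X))
    (φ : C(M × X, Z)) (σ : C(M, X)) (x₀ : M) (p : X) {c : Chains F (sing M)}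
    (hc : component F _ (k + 1) c = c) (hc' : boundary F _ c = 0) :
    chainsMap F (singMap (φ.comp ((ContinuousMap.id M).prodMk σ))) c -
      (chainsMap F (singMap (φ.comp ((ContinuousMap.id M).prodMk (ContinuousMap.const M p)))) c +
        chainsMap F (singMap (φ.comp ((ContinuousMap.const M x₀).prodMk σ))) c) ∈
      LinearMap.range (boundary F (sing Z)) := by
  have : ((sing M).IsConnected) := inferInstanceAs ((TopCat.toSSet.obj (TopCat.of M)).IsConnected)
  have : ((sing X).IsConnected) := inferInstanceAs ((TopCat.toSSet.obj (TopCat.of X)).IsConnected)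
  have hz := kunneth_of_acyclic (F := F) (S := sing M) (Y := sing X) (k := k + 1) (by omega)
    (x₀ := singVertex x₀) (y₀ := singVertex p)
    (fun x => simplexChain_sub_mem_range_boundary F x _)
    (fun y => simplexChain_sub_mem_range_boundary F y _)
    (fun i hi hi' => by
      obtain ⟨i, rfl⟩ : ∃ j, i = j + 1 := ⟨i - 1, by omega⟩
      obtain ⟨j, hj⟩ : ∃ j, k + 1 - (i + 1) = j + 1 := ⟨k - i - 1, by omega⟩
      have h' := h (i + 1) hi hi'
      rw [hj] at h' ⊢
      exact h'.imp (isAcyclicAt_of_subsingleton_H F) (isAcyclicAt_of_subsingleton_H F))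
    -- The Künneth theorem is applied to the image of `c` under the graph map x ↦ (x, σ x), and the
    -- resulting primitive is pushed forward by `φ`.
    (z := chainsMap F (CartesianMonoidalCategory.lift (singMap (ContinuousMap.id M)) (singMap σ)) c)
    (by rw [component_chainsMap, hc]) (by rw [boundary_chainsMap, hc', map_zero])
  obtain ⟨b, hb⟩ := hz
  refine ⟨chainsMap F (singMap₂ φ) b, ?_⟩
  rw [boundary_chainsMap, hb, map_sub, map_add]
  simp only [← chainsMap_comp_apply]
  rfl

end InvariantSection

/-! ### The main theorem -/

open InvariantSection SimplicialChains in
theorem proposition2p3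
    -- a field of coefficients
    (F : Type u) [Field F]
    -- a compact connected (topological) manifold `M`
    {E : Type*} [NormedAddCommGroup E] [NormedSpace ℝ E] [FiniteDimensional ℝ E]
    {M : Type u} [TopologicalSpace M] [ChartedSpace E M] [T2Space M] [CompactSpace M]
    [ConnectedSpace M]
    -- a connected Lie group `G`
    {E' : Type*} [NormedAddCommGroup E'] [NormedSpace ℝ E'] [FiniteDimensional ℝ E']
    {G : Type v} [Group G] [TopologicalSpace G] [ChartedSpace E' G]
    [LieGroup 𝓘(ℝ, E') ∞ G] [ConnectedSpace G]
    -- a compact connected space `X` with a continuous transitive action of `G`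
    {X : Type u} [TopologicalSpace X] [T2Space X] [CompactSpace X] [ConnectedSpace X]
    [MulAction G X] [ContinuousSMul G X] [MulAction.IsPretransitive G X]
    (T : C(M, M)) (hT : T.Homotopic (ContinuousMap.id M))
    (A : C(M, G))
    (k : ℕ) (hk : 1 ≤ k) (hkM : k ≤ Module.finrank ℝ E)
    (h₁ : Nontrivial (InvariantSection.H F k M))
    (h₂ : ∀ i : ℕ, 0 < i → i < k →
      Subsingleton (InvariantSection.H F i M) ∨ Subsingleton (InvariantSection.H F (k - i) X))
    (h₃ : ∃ p : X,
      InvariantSection.inducedMap F k (InvariantSection.orbitMap A p : C(M, X)) ≠ 0) :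
    ¬ ∃ σ : M → X, InvariantSection.IsInvariantSection T A σ := by
  rintro ⟨σ₀, hσ⟩
  obtain ⟨p, hp⟩ := h₃
  obtain ⟨k, rfl⟩ : ∃ l, k = l + 1 := ⟨k - 1, by omega⟩
  apply hp
  let σ : C(M, X) := ⟨σ₀, hσ.continuous⟩
  have : LocallyPathConnectedSpace M := ChartedSpace.locallyPathConnectedSpace E M
  have : PathConnectedSpace M := pathConnectedSpace_iff_connectedSpace.mpr inferInstance
  have : LocallyPathConnectedSpace G := ChartedSpace.locallyPathConnectedSpace E' G
  have : PathConnectedSpace G := pathConnectedSpace_iff_connectedSpace.mpr inferInstance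
  -- By transitivity `X` is the continuous image of the path connected group under g ↦ g p.
  have : PathConnectedSpace X :=
    (MulAction.surjective_smul G p).pathConnectedSpace (continuous_id.smul continuous_const)
  obtain ⟨x₀⟩ : Nonempty M := inferInstance
  let φ : C(M × X, X) := ⟨fun z => A z.1 • z.2, by fun_prop⟩
  have hφ : φ.comp ((ContinuousMap.id M).prodMk σ) = σ.comp T := by
    ext x
    exact congrArg Prod.snd (hσ.invariant x)
  have hσT : (σ.comp T).Homotopic σ :=
    (ContinuousMap.Homotopic.refl σ).comp hT
  have hA : (φ.comp ((ContinuousMap.const M x₀).prodMk σ)).Homotopic σ := by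
    -- Moving A(x₀) to 1 inside `G` deforms the translate A(x₀)σ to σ.
    let γ : Path (A x₀) 1 := PathConnectedSpace.somePath _ _
    exact ⟨⟨⟨fun z => γ z.1 • σ z.2, by fun_prop⟩, fun x => by simp [φ], fun x => by simp⟩⟩
  refine inducedMap_eq_zero F _ fun c hc hc' => ?_
  have e₁ := chainsMap_diagonal_sub_mem F h₂ φ σ x₀ p hc hc'
  have e₂ := chainsMap_sub_mem_of_homotopic F hσT hc hc'
  have e₃ := chainsMap_sub_mem_of_homotopic F hA hc hc'
  rw [hφ] at e₁
  -- On chains: (σT - σ) - (σT - A_p - A(x₀)σ) - (A(x₀)σ - σ) = A_p.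
  have e₄ := Submodule.sub_mem _ (Submodule.sub_mem _ e₂ e₁) e₃
  convert e₄ using 1
  have : φ.comp ((ContinuousMap.id M).prodMk (ContinuousMap.const M p)) = orbitMap A p := rfl
  rw [this]
  abel
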